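/- Let $\mathbb{H}$ be the real quaternions, $\mathbb{B}=\{q\in\mathbb{H}:|q|<1\}$, and for $A\in M_n(\mathbb{H})$ let $\|A\|=\sup_{x\neq 0}\|Ax\|_2/\|x\|_2$ be the operator norm on $\mathbb{H}^n$. A function $f:\mathbb{B}\to\mathbb{H}$ is (left) regular if $f(q)=\sum_{n\ge 0}q^n a_n$ on $\mathbb{B}$ with $a_n\in\mathbb{H}$ and $\limsup_n|a_n|^{1/n}\le 1$. For polynomials with coefficients on the right, the regular product is $\left(\sum q^n a_n\right)*\left(\sum q^n b_n\right)=\sum q^n\sum_{k=0}^n a_k b_{n-k}$. For $h(q)=\sum q^n a_n$ put $h^c(q)=\sum q^n\overline{a_n}$, $h^s=h*h^c$ and $h^{-*}=\frac{1}{h^s}h^c$. A function $f:\mathbb{B}\to\mathbb{H}$ is rational if $f=h^{-*}*g$, that is, $f(q)=h^s(q)^{-1}\,(h^c*g)(q)$ on $\mathbb{B}$, for such polynomials $h,g$ where $h$ has no zeros in $\mathbb{B}$. A matrix-valued function is regular (rational) if all its entries are. A function $R:\mathbb{B}\to M_2(\mathbb{H})$ is inner if at every point of the unit sphere $|q|=1$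 it has a boundary value (its limit from within $\mathbb{B}$) and this value is a unitary matrix. **Theorem.** Let $F:\mathbb{B}\to M_2(\mathbb{H})$ be a non-constant regular function such that $\|F(q)\|=1$ for every $q\in\mathbb{B}$. Then there is a sequence $(R_m)$ of $M_2(\mathbb{H})$-valued rational inner functions on $\mathbb{B}$ which converges to $F$ uniformly on compact subsets of $\mathbb{B}$: for every compact $K\subset\mathbb{B}$ and every $\varepsilon>0$, one has $\|F(q)-R_m(q)\|<\varepsilon$ for all $q\in K$ and all sufficiently large $m$. -/

import Mathlib

open Filter Topology Polynomial
open scoped Quaternion ENNReal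

noncomputable section

namespace QuatApprox

/-- The open unit ball of the quaternions, centred at the origin. -/
def unitBall : Set ℍ := Metric.ball 0 1

/-- A (left) regular function on the unit ball: `f q = ∑ qⁿ aₙ` for `q` in the ball, with
quaternionic coefficients on the right and `limsup |aₙ|^(1/n) ≤ 1`. -/
def IsRegular (f : ℍ → ℍ) : Prop :=
  ∃ a : ℕ → ℍ,
    limsup (fun n : ℕ => (‖a n‖ₑ) ^ (1 / (n : ℝ))) atTop ≤ 1 ∧
    ∀ q ∈ unitBall, HasSum (fun n : ℕ => q ^ n * a n) (f q)

/-- A matrix-valued function is regular if each of its entries is regular. -/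
def IsRegularMatrix {n : ℕ} (F : ℍ → Matrix (Fin n) (Fin n) ℍ) : Prop :=
  ∀ i j, IsRegular (fun q => F q i j)

/-- The value at `q` of the polynomial `∑ qⁿ aₙ` (powers of the variable on the left). In `ℍ[X]`
the variable commutes with the coefficients, so the product of `ℍ[X]` is the regular product
`(∑ qⁿ aₙ) * (∑ qⁿ bₙ) = ∑ qⁿ (∑ₖ aₖ bₙ₋ₖ)`. -/
def evalLeft (q : ℍ) (p : Polynomial ℍ) : ℍ :=
  p.sum fun n a => q ^ n * a

/-- The regular conjugate `hᶜ`: the coefficients are conjugated. -/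
def regConj (p : Polynomial ℍ) : Polynomial ℍ :=
  p.sum fun n a => monomial n (star a)

/-- The symmetrization `hˢ = h * hᶜ`. -/
def symmetrization (p : Polynomial ℍ) : Polynomial ℍ :=
  p * regConj p

/-- A rational function on the unit ball: `f = h^{-*} * g` for polynomials `h`, `g` such that `h`
has no zeros in the ball. Here `h^{-*} = (1 / hˢ) hᶜ`; since `hˢ` has real coefficients, the regular
product of `1 / hˢ` with any regular function is the pointwise product, so that
`(h^{-*} * g) q = (hˢ q)⁻¹ (hᶜ * g) q`. -/
def IsRational (f : ℍ → ℍ) : Prop :=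
  ∃ h g : Polynomial ℍ,
    (∀ q ∈ unitBall, evalLeft q h ≠ 0) ∧
    ∀ q ∈ unitBall, f q = (evalLeft q (symmetrization h))⁻¹ * evalLeft q (regConj h * g)

/-- A matrix-valued function is rational if each of its entries is rational. -/
def IsRationalMatrix {n : ℕ} (F : ℍ → Matrix (Fin n) (Fin n) ℍ) : Prop :=
  ∀ i j, IsRational (fun q => F q i j)

/-- An inner function on the unit ball: at every point of the unit sphere it has a boundary
value (limit from within the ball), which is a unitary matrix. -/
def IsInner {n : ℕ} (F : ℍ → Matrix (Fin n) (Fin n) ℍ) : Prop :=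
  ∀ q : ℍ, ‖q‖ = 1 →
    ∃ W ∈ unitary (Matrix (Fin n) (Fin n) ℍ), Tendsto F (𝓝[unitBall] q) (𝓝 W)

/-- The operator norm `sup_{x ≠ 0} ‖A x‖₂ / ‖x‖₂` of a quaternionic matrix. -/
def opNorm {n : ℕ} (A : Matrix (Fin n) (Fin n) ℍ) : ℝ :=
  sSup {t : ℝ | ∃ x : Fin n → ℍ, x ≠ 0 ∧
    t = ‖WithLp.toLp 2 (A.mulVec x)‖ / ‖WithLp.toLp 2 x‖}

end QuatApprox

end

/-!
A function of constant norm one is, up to constant unitary factors, a scalar function: by Bessel's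
inequality (the mean of `|F x|²` over roots of unity), a unit vector `x` at which `F 0` attains its
norm gives a constant function `q ↦ F q x = v`. In the basis of a unitary matrix `W` with first
column `x` the function becomes `[v, u q]` with `u q ⟂ v`. Since the powers of the variable stand
to the left of the coefficients and do not commute with quaternions, the orthogonality relation
forces `v` to be a real vector up to a right factor. Hence `F = O diag(s, f) W*` with a real
rotation `O` and a scalar regular `f` bounded by one (`exists_factorization`).

It remains to approximate `f` by scalar rational inner functions. The identity
`(p * f)(q) = p(q) f(p(q)⁻¹ q p(q))` and Parseval's identity show that right multiplication by `f`
is a contraction for the `ℓ²`-norm of coefficients (`isSchur_of_norm_seriesVal_le_one`). On such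
power series, with a central variable, the Schur algorithm
`f₁ = X⁻¹ (1 - f ā)⁻¹ (f - a)`, `a = f 0`, can be run (`IsSchur.exists_schur_transform`). After `N`
steps the remainder is replaced by the constant `1` (unless `|a| = 1` occurs earlier, where the
remainder is the constant `a`) and the algorithm is inverted. This yields a
Schur series `h⁻¹ g` which agrees with `f` up to order `N` (`IsSchur.exists_inner_pair`), where
`(h, g)` is built by `(h, g) ↦ (h + X g ā, X g + h a)`. The identity `normSq_schur` shows that this
recursion preserves `|g| ≤ |h| ≠ 0` on the closed ball and `|g| = |h|` on the sphere, so that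
`h^{-*} * g` is rational and inner. Its coefficients are bounded by one, so agreement up to order
`N` gives uniform convergence on compact subsets.
-/

namespace QuatApprox

/-! ### Evaluation of quaternionic polynomials -/

lemma evalLeft_add (q : ℍ) (p g : Polynomial ℍ) :
    evalLeft q (p + g) = evalLeft q p + evalLeft q g :=
  Polynomial.sum_add_index p g _ (by simp) (by simp [mul_add])

@[simp] lemma evalLeft_monomial (q : ℍ) (n : ℕ) (a : ℍ) :
    evalLeft q (monomial n a) = q ^ n * a :=
  Polynomial.sum_monomial_index a _ (by simp)

@[simp] lemma evalLeft_C (q a : ℍ) : evalLeft q (C a) = a := by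
  simpa using evalLeft_monomial q 0 a

lemma evalLeft_mul_monomial (q : ℍ) (p : Polynomial ℍ) (n : ℕ) (a : ℍ) :
    evalLeft q (p * monomial n a) = q ^ n * evalLeft q p * a := by
  induction p using Polynomial.induction_on' with
  | add p g hp hg => simp only [add_mul, evalLeft_add, hp, hg, mul_add]
  | monomial m b =>
    rw [monomial_mul_monomial, evalLeft_monomial, evalLeft_monomial, add_comm, pow_add]
    simp only [mul_assoc]

lemma evalLeft_mul_C (q : ℍ) (p : Polynomial ℍ) (a : ℍ) :
    evalLeft q (p * C a) = evalLeft q p * a := by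
  simpa using evalLeft_mul_monomial q p 0 a

lemma evalLeft_X_mul (q : ℍ) (p : Polynomial ℍ) : evalLeft q (X * p) = q * evalLeft q p := by
  rw [X_mul, ← monomial_one_one_eq_X, evalLeft_mul_monomial, pow_one, mul_one]

lemma mul_conj_pow (p q : ℍ) (hp : p ≠ 0) (n : ℕ) : p * (p⁻¹ * q * p) ^ n = q ^ n * p := by
  have : SemiconjBy p (p⁻¹ * q * p) q := by rw [SemiconjBy, mul_assoc, mul_inv_cancel_left₀ hp]
  exact (this.pow_right n).eq

/-- The regular product is a pointwise product with twisted argument: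
`(p * g)(q) = p(q) g(p(q)⁻¹ q p(q))` wherever `p(q) ≠ 0`. -/
lemma evalLeft_mul (q : ℍ) (p g : Polynomial ℍ) (hp : evalLeft q p ≠ 0) :
    evalLeft q (p * g) =
      evalLeft q p * evalLeft ((evalLeft q p)⁻¹ * q * evalLeft q p) g := by
  induction g using Polynomial.induction_on' with
  | add g k hg hk => simp only [mul_add, evalLeft_add, hg, hk]
  | monomial m b =>
    rw [evalLeft_mul_monomial, evalLeft_monomial, ← mul_assoc, mul_conj_pow _ q hp]

lemma continuous_evalLeft (p : Polynomial ℍ) : Continuous fun q : ℍ => evalLeft q p := by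
  simp only [evalLeft, Polynomial.sum]
  fun_prop

/-! ### Regular conjugate and symmetrization -/

lemma regConj_add (p g : Polynomial ℍ) : regConj (p + g) = regConj p + regConj g :=
  Polynomial.sum_add_index p g _ (by simp) (by simp)

@[simp] lemma regConj_monomial (n : ℕ) (a : ℍ) :
    regConj (monomial n a) = monomial n (star a) :=
  Polynomial.sum_monomial_index a _ (by simp)

lemma coeff_regConj (p : Polynomial ℍ) (n : ℕ) : (regConj p).coeff n = star (p.coeff n) := by
  induction p using Polynomial.induction_on' with
  | add p g hp hg => simp [regConj_add, hp, hg]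
  | monomial m b =>
    rw [regConj_monomial, coeff_monomial, coeff_monomial]
    split_ifs <;> simp

lemma coeff_symmetrization (p : Polynomial ℍ) (n : ℕ) :
    ∃ c : ℝ, (symmetrization p).coeff n = (c : ℍ) := by
  refine ⟨_, Quaternion.star_eq_self.1 ?_⟩
  rw [symmetrization, coeff_mul, star_sum, ← Finset.Nat.sum_antidiagonal_swap]
  simp [coeff_regConj]

lemma evalLeft_symmetrization_commute (q : ℍ) (p : Polynomial ℍ) :
    Commute q (evalLeft q (symmetrization p)) := by
  refine Commute.sum_right _ _ _ fun n _ => ?_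
  obtain ⟨c, hc⟩ := coeff_symmetrization p n
  rw [hc]
  exact (Commute.refl q).pow_right n |>.mul_right (Quaternion.coe_commutes c q).symm

lemma commute_symmetrization (p g : Polynomial ℍ) : Commute g (symmetrization p) := by
  ext1 n
  rw [coeff_mul, coeff_mul, ← Finset.Nat.sum_antidiagonal_swap]
  refine Finset.sum_congr rfl fun x _ => ?_
  obtain ⟨c, hc⟩ := coeff_symmetrization p x.1
  simp only [Prod.fst_swap, Prod.snd_swap, hc]
  exact (Quaternion.coe_commutes c _).symm

/-- The symmetrization does not depend on the order of the two factors, because it is central. -/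
lemma regConj_mul_self (p : Polynomial ℍ) : regConj p * p = symmetrization p := by
  by_cases hp : p = 0
  · simp [hp, symmetrization]
  · apply mul_left_cancel₀ hp
    rw [← mul_assoc, ← symmetrization, (commute_symmetrization p p).eq]

/-- Powers are affine on a sphere of fixed real part and norm, by `x² = 2 Re(x) x - |x|²`. -/
lemma exists_pow_eq_add_mul (ρ t : ℝ) (n : ℕ) :
    ∃ α β : ℝ, ∀ x : ℍ, x.re = t → ‖x‖ = ρ → x ^ n = (α : ℍ) + x * (β : ℍ) := by
  induction n with
  | zero => exact ⟨1, 0, fun x _ _ => by simp⟩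
  | succ n ih =>
    obtain ⟨α, β, h⟩ := ih
    refine ⟨-(ρ ^ 2 * β), α + 2 * t * β, fun x hx hn => ?_⟩
    have hsq : x * x = (2 * t : ℝ) * x - (ρ ^ 2 : ℝ) := by
      have h1 : x + star x = ((2 * t : ℝ) : ℍ) := by
        rw [← hx]; exact Quaternion.self_add_star' x
      have h2 : x * star x = ((ρ ^ 2 : ℝ) : ℍ) := by
        rw [Quaternion.self_mul_star, Quaternion.normSq_eq_norm_mul_self, hn, sq]
      rw [← h2, ← h1, add_mul, Quaternion.self_mul_star, Quaternion.star_mul_self]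
      abel
    rw [pow_succ', h x hx hn, mul_add, ← mul_assoc, hsq]
    ext <;> simp <;> ring

/-- On a sphere `t + s 𝕊` of quaternions with fixed real part and norm, every polynomial is affine,
`p(x) = A + x B`, and its regular conjugate is obtained by conjugating `A` and `B`. -/
lemma exists_evalLeft_eq_add_mul (ρ t : ℝ) (p : Polynomial ℍ) :
    ∃ A B : ℍ, ∀ x : ℍ, x.re = t → ‖x‖ = ρ →
      evalLeft x p = A + x * B ∧ evalLeft x (regConj p) = star A + x * star B := by
  induction p using Polynomial.induction_on' with
  | add p g hp hg =>
    obtain ⟨A, B, h⟩ := hp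
    obtain ⟨A', B', h'⟩ := hg
    refine ⟨A + A', B + B', fun x hx hn => ?_⟩
    rw [regConj_add, evalLeft_add, evalLeft_add, (h x hx hn).1, (h x hx hn).2, (h' x hx hn).1,
      (h' x hx hn).2, star_add, star_add]
    constructor <;> · rw [mul_add]; abel
  | monomial m b =>
    obtain ⟨α, β, h⟩ := exists_pow_eq_add_mul ρ t m
    refine ⟨α * b, β * b, fun x hx hn => ?_⟩
    rw [regConj_monomial, evalLeft_monomial, evalLeft_monomial, h x hx hn, star_mul, star_mul,
      Quaternion.star_coe, Quaternion.star_coe, ← Quaternion.coe_commutes α (star b),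
      ← Quaternion.coe_commutes β (star b)]
    constructor <;> rw [add_mul, mul_assoc]

lemma norm_conj (p q : ℍ) (hp : p ≠ 0) : ‖p⁻¹ * q * p‖ = ‖q‖ := by
  have : ‖p‖ ≠ 0 := norm_ne_zero_iff.2 hp
  rw [norm_mul, norm_mul, norm_inv]
  field_simp

lemma re_conj (p q : ℍ) (hp : p ≠ 0) : (p⁻¹ * q * p).re = q.re := by
  have h (x y : ℍ) : (x * y).re = (y * x).re := by simp; ring
  rw [h, ← mul_assoc, mul_inv_cancel₀ hp, one_mul]

/-- If `h` has no zeros on the sphere through `q`, then neither has its regular conjugate. -/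
lemma evalLeft_regConj_ne_zero (p : Polynomial ℍ) (q : ℍ)
    (h : ∀ x : ℍ, ‖x‖ = ‖q‖ → evalLeft x p ≠ 0) : evalLeft q (regConj p) ≠ 0 := by
  intro h0
  obtain ⟨A, B, hAB⟩ := exists_evalLeft_eq_add_mul ‖q‖ q.re p
  rw [(hAB q rfl rfl).2] at h0
  have hA : A = -(B * star q) := by
    have := congrArg star h0
    simp only [star_add, star_star, star_mul, star_zero] at this
    exact eq_neg_of_add_eq_zero_left this
  by_cases hB : B = 0
  · refine h q rfl ?_
    rw [(hAB q rfl rfl).1, hA, hB]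
    simp
  · have hn : ‖B * star q * B⁻¹‖ = ‖q‖ := by
      have := norm_conj B⁻¹ (star q) (inv_ne_zero hB)
      rwa [inv_inv, norm_star] at this
    have hr : (B * star q * B⁻¹).re = q.re := by
      have := re_conj B⁻¹ (star q) (inv_ne_zero hB)
      rwa [inv_inv, Quaternion.re_star] at this
    refine h _ hn ?_
    rw [(hAB _ hr hn).1, hA, mul_assoc _ B⁻¹, inv_mul_cancel₀ hB, mul_one, neg_add_cancel]

/-- The identity behind the Schur algorithm. Since `a` multiplies from the right, it applies both to values
of polynomials and to coefficients of power series. -/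
lemma normSq_schur (x y a : ℍ) :
    ‖x + y * star a‖ ^ 2 - ‖y + x * a‖ ^ 2 = (1 - ‖a‖ ^ 2) * (‖x‖ ^ 2 - ‖y‖ ^ 2) := by
  have h (z : ℍ) : ‖z‖ ^ 2 = Quaternion.normSq z := by
    rw [Quaternion.normSq_eq_norm_mul_self, sq]
  have hre (z : ℍ) : (star z).re = z.re := Quaternion.re_star z
  simp only [h, Quaternion.normSq_add, map_mul, Quaternion.normSq_star]
  have : (x * star (y * star a)).re = (y * star (x * a)).re := by
    rw [← hre (y * star (x * a))]
    simp [mul_assoc]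
  rw [this]
  ring

/-! ### The Schur algorithm for quaternionic power series -/

/-- The squared `ℓ²`-norm of the first `N` coefficients of a power series. -/
noncomputable def partialSq (g : PowerSeries ℍ) (N : ℕ) : ℝ :=
  ∑ n ∈ Finset.range N, ‖PowerSeries.coeff n g‖ ^ 2

/-- The Schur class: power series which, as right multipliers, are contractions for all the
truncated `ℓ²`-norms. In `PowerSeries ℍ` the variable is central, so that the product is the
regular product. -/
def IsSchur (f : PowerSeries ℍ) : Prop :=
  ∀ g N, partialSq (g * f) N ≤ partialSq g N

lemma partialSq_X_mul (g : PowerSeries ℍ) (N : ℕ) :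
    partialSq (PowerSeries.X * g) (N + 1) = partialSq g N := by
  simp [partialSq, Finset.sum_range_succ', PowerSeries.coeff_succ_X_mul]

lemma partialSq_mono (g : PowerSeries ℍ) {M N : ℕ} (h : M ≤ N) : partialSq g M ≤ partialSq g N :=
  Finset.sum_le_sum_of_subset_of_nonneg (Finset.range_mono h) fun _ _ _ => by positivity

lemma partialSq_congr {g k : PowerSeries ℍ} {N : ℕ}
    (h : ∀ n < N, PowerSeries.coeff n g = PowerSeries.coeff n k) :
    partialSq g N = partialSq k N :=
  Finset.sum_congr rfl fun n hn => by rw [h n (Finset.mem_range.1 hn)]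

lemma IsSchur.mul {f g : PowerSeries ℍ} (hf : IsSchur f) (hg : IsSchur g) : IsSchur (f * g) :=
  fun k N => by rw [← mul_assoc]; exact (hg _ N).trans (hf k N)

lemma isSchur_X : IsSchur PowerSeries.X := by
  intro g N
  rw [(PowerSeries.commute_X g).eq]
  cases N with
  | zero => simp [partialSq]
  | succ N =>
    rw [partialSq_X_mul]
    exact partialSq_mono g N.le_succ

lemma isSchur_C {a : ℍ} (ha : ‖a‖ ≤ 1) : IsSchur (PowerSeries.C a) := by
  intro g N
  refine Finset.sum_le_sum fun n _ => ?_
  rw [PowerSeries.coeff_mul_C, norm_mul]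
  gcongr
  exact mul_le_of_le_one_right (norm_nonneg _) ha

lemma IsSchur.partialSq_le_one {f : PowerSeries ℍ} (hf : IsSchur f) (N : ℕ) :
    partialSq f N ≤ 1 := by
  refine (partialSq_mono f N.le_succ).trans ?_
  have := hf 1 (N + 1)
  rw [one_mul] at this
  refine this.trans (le_of_eq ?_)
  simp [partialSq, Finset.sum_range_succ', PowerSeries.coeff_one]

lemma IsSchur.norm_coeff_le_one {f : PowerSeries ℍ} (hf : IsSchur f) (n : ℕ) :
    ‖PowerSeries.coeff n f‖ ≤ 1 := by
  have h1 := hf.partialSq_le_one (n + 1)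
  have h2 : ‖PowerSeries.coeff n f‖ ^ 2 ≤ partialSq f (n + 1) :=
    Finset.single_le_sum (f := fun n => ‖PowerSeries.coeff n f‖ ^ 2)
      (fun _ _ => by positivity) (Finset.self_mem_range_succ n)
  exact (sq_le_one_iff₀ (norm_nonneg _)).1 (h2.trans h1)

lemma partialSq_schur (x y : PowerSeries ℍ) (a : ℍ) (N : ℕ) :
    partialSq (x + y * PowerSeries.C (star a)) N - partialSq (y + x * PowerSeries.C a) N =
      (1 - ‖a‖ ^ 2) * (partialSq x N - partialSq y N) := by
  simp only [partialSq, ← Finset.sum_sub_distrib, Finset.mul_sum, map_add,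
    PowerSeries.coeff_mul_C, normSq_schur]

lemma IsSchur.eq_C_of_norm_eq_one {f : PowerSeries ℍ} (hf : IsSchur f)
    (h : ‖PowerSeries.coeff 0 f‖ = 1) : f = PowerSeries.C (PowerSeries.coeff 0 f) := by
  ext1 n
  cases n with
  | zero => simp
  | succ n =>
    have h1 := hf.partialSq_le_one (n + 2)
    rw [partialSq, Finset.sum_range_succ', h, Finset.sum_range_succ] at h1
    have h2 : 0 ≤ ∑ x ∈ Finset.range n, ‖PowerSeries.coeff (x + 1) f‖ ^ 2 := by positivity
    have h3 : ‖PowerSeries.coeff (n + 1) f‖ ^ 2 = 0 :=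
      le_antisymm (by linarith) (by positivity)
    rw [PowerSeries.coeff_C, if_neg n.succ_ne_zero]
    simpa using h3

lemma exists_inv_of_coeff_zero_ne_zero (u : PowerSeries ℍ) (h : PowerSeries.coeff 0 u ≠ 0) :
    ∃ w, u * w = 1 ∧ w * u = 1 :=
  ⟨PowerSeries.invOfUnit u (Units.mk0 _ h), PowerSeries.mul_invOfUnit _ _ (by simp),
    PowerSeries.invOfUnit_mul _ _ (by simp)⟩

/-- The Schur transform `f₁ = X⁻¹ (1 - f ā)⁻¹ (f - a)`, where `a = f(0)`, stays in the Schur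
class. -/
lemma IsSchur.exists_schur_transform {f : PowerSeries ℍ} (hf : IsSchur f)
    (ha : ‖PowerSeries.coeff 0 f‖ < 1) :
    ∃ f₁, IsSchur f₁ ∧
      (1 + PowerSeries.X * f₁ * PowerSeries.C (star (PowerSeries.coeff 0 f))) * f =
        PowerSeries.X * f₁ + PowerSeries.C (PowerSeries.coeff 0 f) := by
  set a := PowerSeries.coeff 0 f with ha'
  have ha2 : 0 < 1 - ‖a‖ ^ 2 := by nlinarith [norm_nonneg a]
  have haa : a * star a = ((‖a‖ ^ 2 : ℝ) : ℍ) := by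
    rw [Quaternion.self_mul_star, Quaternion.normSq_eq_norm_mul_self, sq]
  have hcomm : star a * a = a * star a := by
    rw [Quaternion.self_mul_star, Quaternion.star_mul_self]
  set u : PowerSeries ℍ := 1 - f * PowerSeries.C (star a) with hu
  have hu0 : PowerSeries.coeff 0 u ≠ 0 := by
    rw [hu, map_sub, PowerSeries.coeff_mul_C, ← ha', haa, PowerSeries.coeff_zero_one]
    intro h0
    have := congrArg QuaternionAlgebra.re h0
    simp only [Quaternion.re_sub, Quaternion.re_one, Quaternion.re_coe, Quaternion.re_zero] at this
    linarith
  obtain ⟨w, huw, hwu⟩ := exists_inv_of_coeff_zero_ne_zero u hu0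
  obtain ⟨t, ht⟩ : ∃ t, f - PowerSeries.C a = PowerSeries.X * t := by
    rw [ha', PowerSeries.coeff_zero_eq_constantCoeff_apply]
    exact ⟨_, PowerSeries.sub_const_eq_X_mul_shift f⟩
  have hX : PowerSeries.X * (w * t) = w * (f - PowerSeries.C a) := by
    rw [ht, ← mul_assoc, ← mul_assoc, (PowerSeries.commute_X w).eq]
  refine ⟨w * t, fun g N => ?_, ?_⟩
  · -- Only the first `N` coefficients of `g` matter, so `g` may be replaced by its truncation.
    set g' : PowerSeries ℍ := ((PowerSeries.trunc N g : Polynomial ℍ) : PowerSeries ℍ) with hg'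
    have hgg' : ∀ n < N, PowerSeries.coeff n g = PowerSeries.coeff n g' := fun n hn => by
      rw [hg', Polynomial.coeff_coe, PowerSeries.coeff_trunc, if_pos hn]
    have e1 : partialSq (g * (w * t)) N = partialSq (g' * (w * t)) N := by
      refine partialSq_congr fun n hn => ?_
      rw [PowerSeries.coeff_mul, PowerSeries.coeff_mul]
      refine Finset.sum_congr rfl fun x hx => ?_
      rw [hgg' _ ((Finset.HasAntidiagonal.antidiagonal.fst_le hx).trans_lt hn)]
    have e2 : partialSq g' (N + 1) = partialSq g N := by
      rw [partialSq, Finset.sum_range_succ, ← partialSq, ← partialSq_congr hgg', hg',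
        Polynomial.coeff_coe, PowerSeries.coeff_trunc, if_neg (lt_irrefl N)]
      simp
    -- With `g' = k (1 - f ā)` one has `X g' f₁ = k (f - a)`.
    set k := g' * w with hk
    have e3 : g' = k + -(k * f) * PowerSeries.C (star a) := by
      rw [hk, neg_mul, ← sub_eq_add_neg, mul_assoc, mul_assoc, ← mul_sub]
      have : w - w * (f * PowerSeries.C (star a)) = w * u := by rw [hu, mul_sub, mul_one]
      rw [this, hwu, mul_one]
    have e4 : PowerSeries.X * (g' * (w * t)) = -(-(k * f) + k * PowerSeries.C a) := by
      rw [← mul_assoc, ← (PowerSeries.commute_X g').eq, mul_assoc, hX, ← mul_assoc, ← hk, mul_sub]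
      abel
    have e5 (x : PowerSeries ℍ) (M : ℕ) : partialSq (-x) M = partialSq x M := by
      simp [partialSq]
    have key := partialSq_schur k (-(k * f)) a (N + 1)
    rw [← e3, e5, e2, ← e5 (_ + _), ← e4, partialSq_X_mul] at key
    have := mul_nonneg ha2.le (sub_nonneg.2 (hf k (N + 1)))
    rw [e1]
    linarith
  · have hc : PowerSeries.C a * PowerSeries.C (star a) * f
        = f * (PowerSeries.C (star a) * PowerSeries.C a) := by
      rw [← map_mul, ← map_mul, hcomm, haa]
      ext1 n
      rw [PowerSeries.coeff_mul_C, PowerSeries.coeff_C_mul, Quaternion.coe_commutes]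
    rw [hX]
    have h1 : u * ((1 + w * (f - PowerSeries.C a) * PowerSeries.C (star a)) * f)
        = u * (w * (f - PowerSeries.C a) + PowerSeries.C a) := by
      have l : u * ((1 + w * (f - PowerSeries.C a) * PowerSeries.C (star a)) * f)
          = (u + u * w * (f - PowerSeries.C a) * PowerSeries.C (star a)) * f := by noncomm_ring
      have r : u * (w * (f - PowerSeries.C a) + PowerSeries.C a)
          = u * w * (f - PowerSeries.C a) + u * PowerSeries.C a := by noncomm_ring
      rw [l, r, huw, hu]
      simp only [one_mul, sub_mul, add_mul, mul_assoc] at hc ⊢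
      rw [hc]
      abel
    have h2 := congrArg (w * ·) h1
    simpa only [← mul_assoc, hwu, one_mul] using h2

/-- The inverse Schur transform `r = (1 + X r₁ ā)⁻¹ (X r₁ + a)` preserves the Schur class. -/
lemma IsSchur.exists_inverse_schur_transform {r₁ : PowerSeries ℍ} (hr : IsSchur r₁) {a : ℍ}
    (ha : ‖a‖ < 1) :
    ∃ r, IsSchur r ∧ (1 + PowerSeries.X * r₁ * PowerSeries.C (star a)) * r =
        PowerSeries.X * r₁ + PowerSeries.C a := by
  have ha2 : 0 < 1 - ‖a‖ ^ 2 := by nlinarith [norm_nonneg a]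
  set v : PowerSeries ℍ := 1 + PowerSeries.X * r₁ * PowerSeries.C (star a) with hv
  obtain ⟨w, hvw, hwv⟩ := exists_inv_of_coeff_zero_ne_zero v (by
    rw [hv, map_add, PowerSeries.coeff_mul_C, PowerSeries.coeff_zero_X_mul]; simp)
  refine ⟨w * (PowerSeries.X * r₁ + PowerSeries.C a), fun g N => ?_, by
    rw [← mul_assoc, hvw, one_mul]⟩
  -- With `g = l (1 + X r₁ ā)` one has `g r = l (X r₁ + a)`.
  set l := g * w with hl
  have e1 : g = l + l * (PowerSeries.X * r₁) * PowerSeries.C (star a) := by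
    have : l + l * (PowerSeries.X * r₁) * PowerSeries.C (star a) = l * v := by
      rw [hv]; noncomm_ring
    rw [this, hl, mul_assoc, hwv, mul_one]
  have e2 : g * (w * (PowerSeries.X * r₁ + PowerSeries.C a))
      = l * (PowerSeries.X * r₁) + l * PowerSeries.C a := by
    rw [hl]; noncomm_ring
  have key := partialSq_schur l (l * (PowerSeries.X * r₁)) a N
  rw [← e1, ← e2] at key
  have := mul_nonneg ha2.le (sub_nonneg.2 ((isSchur_X.mul hr) l N))
  linarith

/-- Inverse Schur transforms of two series which agree up to order `N` agree up to
order `N + 1`. -/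
lemma coeff_eq_of_schur_transform {f₁ r₁ f r : PowerSeries ℍ} {a : ℍ} {N : ℕ}
    (hf : (1 + PowerSeries.X * f₁ * PowerSeries.C (star a)) * f =
        PowerSeries.X * f₁ + PowerSeries.C a)
    (hr : (1 + PowerSeries.X * r₁ * PowerSeries.C (star a)) * r =
        PowerSeries.X * r₁ + PowerSeries.C a)
    (h : ∀ n < N, PowerSeries.coeff n r₁ = PowerSeries.coeff n f₁) :
    ∀ n < N + 1, PowerSeries.coeff n r = PowerSeries.coeff n f := by
  set v : PowerSeries ℍ := 1 + PowerSeries.X * r₁ * PowerSeries.C (star a) with hv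
  obtain ⟨w, hvw, hwv⟩ := exists_inv_of_coeff_zero_ne_zero v (by
    rw [hv, map_add, PowerSeries.coeff_mul_C, PowerSeries.coeff_zero_X_mul]; simp)
  obtain ⟨c, hc⟩ : PowerSeries.X ^ N ∣ r₁ - f₁ :=
    PowerSeries.X_pow_dvd_iff.2 fun n hn => by rw [map_sub, h n hn, sub_self]
  have h1 : v * (r - f) = PowerSeries.X ^ (N + 1) * (c * (1 - PowerSeries.C (star a) * f)) := by
    have : v * (r - f) = PowerSeries.X * (r₁ - f₁) * (1 - PowerSeries.C (star a) * f) := by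
      have e : v * f = PowerSeries.X * f₁ + PowerSeries.C a
          + PowerSeries.X * (r₁ - f₁) * PowerSeries.C (star a) * f := by
        rw [← hf, hv]; noncomm_ring
      rw [mul_sub, hr, e]; noncomm_ring
    rw [this, hc, pow_succ']
    simp only [mul_assoc]
  have h2 : r - f = PowerSeries.X ^ (N + 1) * (w * (c * (1 - PowerSeries.C (star a) * f))) := by
    rw [← mul_assoc, ← (PowerSeries.commute_X_pow w (N + 1)).eq, mul_assoc, ← h1, ← mul_assoc,
      hwv, one_mul]
  intro n hn
  rw [← sub_eq_zero, ← map_sub]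
  exact PowerSeries.X_pow_dvd_iff.1 ⟨_, h2⟩ n hn

/-- The pairs `(h, g)` of denominators and numerators which the inverse Schur algorithm produces:
`h` has no zeros in the closed ball, `|g| ≤ |h|` there, and `|g| = |h|` on the sphere. -/
def IsInnerPair (h g : Polynomial ℍ) : Prop :=
  ∀ q : ℍ, ‖q‖ ≤ 1 → evalLeft q h ≠ 0 ∧ ‖evalLeft q g‖ ≤ ‖evalLeft q h‖ ∧
    (‖q‖ = 1 → ‖evalLeft q g‖ = ‖evalLeft q h‖)

lemma IsInnerPair.schur_step {h g : Polynomial ℍ} (hp : IsInnerPair h g) {a : ℍ} (ha : ‖a‖ < 1) :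
    IsInnerPair (h + X * g * C (star a)) (X * g + h * C a) := by
  intro q hq
  obtain ⟨h0, hle, heq⟩ := hp q hq
  have ha2 : 0 < 1 - ‖a‖ ^ 2 := by nlinarith [norm_nonneg a]
  rw [evalLeft_add, evalLeft_add, evalLeft_mul_C, evalLeft_mul_C, evalLeft_X_mul]
  set x := evalLeft q h
  set y := q * evalLeft q g with hy
  have hyx : ‖y‖ ≤ ‖x‖ := by
    rw [hy, norm_mul]
    exact (mul_le_of_le_one_left (norm_nonneg _) hq).trans hle
  have key := normSq_schur x y a
  refine ⟨fun h1 => ?_, ?_, fun h1 => ?_⟩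
  · have h2 : ‖x‖ = ‖y‖ * ‖a‖ := by
      rw [eq_neg_of_add_eq_zero_left h1, norm_neg, norm_mul, norm_star]
    have h3 : 0 < ‖x‖ := norm_pos_iff.2 h0
    nlinarith [norm_nonneg a, norm_nonneg y]
  · refine (sq_le_sq₀ (norm_nonneg _) (norm_nonneg _)).1 ?_
    have : 0 ≤ ‖x‖ ^ 2 - ‖y‖ ^ 2 :=
      sub_nonneg.2 ((sq_le_sq₀ (norm_nonneg _) (norm_nonneg _)).2 hyx)
    nlinarith [mul_nonneg ha2.le this]
  · have h2 : ‖y‖ = ‖x‖ := by rw [hy, norm_mul, h1, one_mul, heq h1]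
    rw [h2, sub_self, mul_zero, sub_eq_zero] at key
    exact ((sq_eq_sq₀ (norm_nonneg _) (norm_nonneg _)).1 key).symm

/-- Every Schur series agrees up to any given order with the Schur series of a rational inner
function `h⁻¹ g`. -/
lemma IsSchur.exists_inner_pair (N : ℕ) : ∀ {f : PowerSeries ℍ}, IsSchur f →
    ∃ h g : Polynomial ℍ, ∃ r : PowerSeries ℍ, IsInnerPair h g ∧ IsSchur r ∧
      (h : PowerSeries ℍ) * r = g ∧ ∀ n < N, PowerSeries.coeff n r = PowerSeries.coeff n f := by
  have const (a : ℍ) (ha : ‖a‖ = 1) : ∃ h g : Polynomial ℍ, IsInnerPair h g ∧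
      (h : PowerSeries ℍ) * PowerSeries.C a = g :=
    ⟨1, C a, fun q _ => by rw [← C_1, evalLeft_C, evalLeft_C]; simp [ha], by simp⟩
  induction N with
  | zero =>
    intro f _
    obtain ⟨h, g, hp, he⟩ := const 1 norm_one
    exact ⟨h, g, _, hp, isSchur_C norm_one.le, he, by simp⟩
  | succ N ih =>
    intro f hf
    rcases (hf.norm_coeff_le_one 0).eq_or_lt with ha | ha
    · obtain ⟨h, g, hp, he⟩ := const _ ha
      refine ⟨h, g, _, hp, isSchur_C ha.le, he, fun n _ => ?_⟩
      rw [← hf.eq_C_of_norm_eq_one ha]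
    · obtain ⟨f₁, hf₁, hff₁⟩ := hf.exists_schur_transform ha
      obtain ⟨h, g, r₁, hp, hr₁, he, hc⟩ := ih hf₁
      obtain ⟨r, hr, hrr₁⟩ := hr₁.exists_inverse_schur_transform ha
      refine ⟨_, _, r, hp.schur_step ha, hr, ?_, coeff_eq_of_schur_transform hff₁ hrr₁ hc⟩
      have e : ((h + X * g * C (star (PowerSeries.coeff 0 f)) : Polynomial ℍ) : PowerSeries ℍ)
          = (h : PowerSeries ℍ) *
            (1 + PowerSeries.X * r₁ * PowerSeries.C (star (PowerSeries.coeff 0 f))) := by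
        rw [Polynomial.coe_add, Polynomial.coe_mul, Polynomial.coe_mul, Polynomial.coe_X,
          Polynomial.coe_C, ← he, mul_add, mul_one, ← mul_assoc, ← mul_assoc, ← mul_assoc,
          (PowerSeries.commute_X (h : PowerSeries ℍ)).eq]
      rw [e, mul_assoc, hrr₁, mul_add, ← mul_assoc, (PowerSeries.commute_X _).eq, mul_assoc, he]
      simp

/-! ### Values of power series -/

/-- The value `∑ qⁿ aₙ` at `q` of a power series (zero where the series diverges). -/
noncomputable def seriesVal (q : ℍ) (r : PowerSeries ℍ) : ℍ :=
  ∑' n, q ^ n * PowerSeries.coeff n r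

/-- Absolute convergence of a power series on the open unit ball. -/
def ConvergesOnBall (r : PowerSeries ℍ) : Prop :=
  ∀ ρ : ℝ, 0 ≤ ρ → ρ < 1 → Summable fun n => ρ ^ n * ‖PowerSeries.coeff n r‖

lemma ConvergesOnBall.summable_mul {r : PowerSeries ℍ} (hr : ConvergesOnBall r) {q : ℍ}
    (hq : ‖q‖ < 1) (c : ℍ) : Summable fun n => q ^ n * c * PowerSeries.coeff n r := by
  refine .of_norm (((hr ‖q‖ (norm_nonneg q) hq).mul_left ‖c‖).congr fun n => ?_)
  rw [norm_mul, norm_mul, norm_pow]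
  ring

lemma ConvergesOnBall.hasSum {r : PowerSeries ℍ} (hr : ConvergesOnBall r) {q : ℍ}
    (hq : ‖q‖ < 1) : HasSum (fun n => q ^ n * PowerSeries.coeff n r) (seriesVal q r) := by
  simpa [seriesVal] using (hr.summable_mul hq 1).hasSum

lemma convergesOnBall_of_summable {r : PowerSeries ℍ}
    (h : ∀ q : ℍ, ‖q‖ < 1 → Summable fun n => q ^ n * PowerSeries.coeff n r) :
    ConvergesOnBall r := by
  intro ρ h0 h1
  refine ((h (ρ : ℍ) ?_).norm).congr fun n => ?_
  · rwa [Quaternion.norm_coe, Real.norm_of_nonneg h0]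
  · rw [norm_mul, norm_pow, Quaternion.norm_coe, Real.norm_of_nonneg h0]

lemma convergesOnBall_of_norm_coeff_le {r : PowerSeries ℍ} {B : ℝ}
    (h : ∀ n, ‖PowerSeries.coeff n r‖ ≤ B) : ConvergesOnBall r := fun ρ h0 h1 =>
  .of_nonneg_of_le (fun n => by positivity) (fun n => by gcongr; exact h n)
    ((summable_geometric_of_lt_one h0 h1).mul_right B)

lemma IsSchur.convergesOnBall {r : PowerSeries ℍ} (hr : IsSchur r) : ConvergesOnBall r :=
  convergesOnBall_of_norm_coeff_le hr.norm_coeff_le_one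

lemma hasSum_coe (p : Polynomial ℍ) (q : ℍ) :
    HasSum (fun n => q ^ n * PowerSeries.coeff n (p : PowerSeries ℍ)) (evalLeft q p) := by
  simp only [Polynomial.coeff_coe]
  refine hasSum_sum_of_ne_finset_zero fun n hn => ?_
  rw [Polynomial.notMem_support_iff.1 hn, mul_zero]

lemma convergesOnBall_coe (p : Polynomial ℍ) : ConvergesOnBall (p : PowerSeries ℍ) :=
  convergesOnBall_of_summable fun q _ => (hasSum_coe p q).summable

lemma seriesVal_coe (p : Polynomial ℍ) (q : ℍ) :
    seriesVal q (p : PowerSeries ℍ) = evalLeft q p :=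
  (hasSum_coe p q).tsum_eq

lemma hasSum_coe_mul (p : Polynomial ℍ) {r : PowerSeries ℍ} (hr : ConvergesOnBall r) {q : ℍ}
    (hq : ‖q‖ < 1) :
    HasSum (fun n => q ^ n * PowerSeries.coeff n ((p : PowerSeries ℍ) * r))
      (∑' n, q ^ n * evalLeft q p * PowerSeries.coeff n r) := by
  induction p using Polynomial.induction_on' with
  | add p g hp hg =>
    convert! hp.add hg using 1
    · ext1 n
      rw [Polynomial.coe_add, add_mul, map_add, mul_add]
    · rw [← (hr.summable_mul hq _).tsum_add (hr.summable_mul hq _)]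
      simp only [evalLeft_add, mul_add, add_mul]
  | monomial k a =>
    have e (n : ℕ) : PowerSeries.coeff n (((monomial k a : Polynomial ℍ) : PowerSeries ℍ) * r)
        = if k ≤ n then a * PowerSeries.coeff (n - k) r else 0 := by
      rw [← C_mul_X_pow_eq_monomial, Polynomial.coe_mul, Polynomial.coe_pow, Polynomial.coe_X,
        Polynomial.coe_C, mul_assoc, PowerSeries.coeff_C_mul, PowerSeries.coeff_X_pow_mul']
      split_ifs <;> simp
    simp only [e]
    rw [← (add_left_injective k).hasSum_iff]
    · convert! (hr.summable_mul hq (q ^ k * a)).hasSum using 1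
      · ext1 n
        simp [pow_add, mul_assoc]
      · rw [evalLeft_monomial]
    · intro n hn
      rw [if_neg, mul_zero]
      exact fun h => hn ⟨n - k, Nat.sub_add_cancel h⟩

lemma convergesOnBall_coe_mul (p : Polynomial ℍ) {r : PowerSeries ℍ} (hr : ConvergesOnBall r) :
    ConvergesOnBall ((p : PowerSeries ℍ) * r) :=
  convergesOnBall_of_summable fun _ hq => (hasSum_coe_mul p hr hq).summable

/-- If `|r| ≤ 1` on the sphere through `q`, then `|(p * r)(q)| ≤ |p(q)|`, because the regular
product is a pointwise product with an argument twisted inside this sphere. -/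
lemma norm_seriesVal_coe_mul_le (p : Polynomial ℍ) {r : PowerSeries ℍ} (hr : ConvergesOnBall r)
    (h1 : ∀ q : ℍ, ‖q‖ < 1 → ‖seriesVal q r‖ ≤ 1) {q : ℍ} (hq : ‖q‖ < 1) :
    ‖seriesVal q ((p : PowerSeries ℍ) * r)‖ ≤ ‖evalLeft q p‖ := by
  rw [seriesVal, (hasSum_coe_mul p hr hq).tsum_eq]
  set c := evalLeft q p
  by_cases hc : c = 0
  · simp [hc]
  · have hw : ‖c⁻¹ * q * c‖ < 1 := by rwa [norm_conj c q hc]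
    have e : ∑' n, q ^ n * c * PowerSeries.coeff n r = c * seriesVal (c⁻¹ * q * c) r := by
      rw [seriesVal, ← (hr.hasSum hw).summable.tsum_mul_left]
      refine tsum_congr fun n => ?_
      rw [← mul_assoc, mul_conj_pow c q hc]
    rw [e, norm_mul]
    exact mul_le_of_le_one_right (norm_nonneg c) (h1 _ hw)

lemma evalLeft_symmetrization (h : Polynomial ℍ) (q : ℍ) (hc : evalLeft q (regConj h) ≠ 0) :
    evalLeft q (symmetrization h) = evalLeft q (regConj h) *
      evalLeft ((evalLeft q (regConj h))⁻¹ * q * evalLeft q (regConj h)) h := by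
  rw [← regConj_mul_self, evalLeft_mul q _ h hc]

lemma IsInnerPair.evalLeft_regConj_ne_zero {h g : Polynomial ℍ} (hp : IsInnerPair h g) {q : ℍ}
    (hq : ‖q‖ ≤ 1) : evalLeft q (regConj h) ≠ 0 :=
  QuatApprox.evalLeft_regConj_ne_zero h q fun x hx => (hp x (hx.trans_le hq)).1

lemma IsInnerPair.evalLeft_symmetrization_ne_zero {h g : Polynomial ℍ} (hp : IsInnerPair h g)
    {q : ℍ} (hq : ‖q‖ ≤ 1) : evalLeft q (symmetrization h) ≠ 0 := by
  have hc := hp.evalLeft_regConj_ne_zero hq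
  rw [evalLeft_symmetrization h q hc]
  exact mul_ne_zero hc (hp _ (by rwa [norm_conj _ q hc])).1

/-- The value of `h^{-*} * g` at `q`. -/
noncomputable def quotVal (h g : Polynomial ℍ) (q : ℍ) : ℍ :=
  (evalLeft q (symmetrization h))⁻¹ * evalLeft q (regConj h * g)

lemma IsInnerPair.norm_quotVal {h g : Polynomial ℍ} (hp : IsInnerPair h g) {q : ℍ}
    (hq : ‖q‖ = 1) : ‖quotVal h g q‖ = 1 := by
  have hc := hp.evalLeft_regConj_ne_zero hq.le
  have hw := (norm_conj _ q hc).trans hq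
  have h0 := (hp _ hw.le).1
  rw [quotVal, evalLeft_symmetrization h q hc, evalLeft_mul q _ g hc, norm_mul, norm_inv, norm_mul,
    norm_mul, (hp _ hw.le).2.2 hw, inv_mul_cancel₀]
  exact mul_ne_zero (norm_ne_zero_iff.2 hc) (norm_ne_zero_iff.2 h0)

lemma IsInnerPair.continuousAt_quotVal {h g : Polynomial ℍ} (hp : IsInnerPair h g) {q : ℍ}
    (hq : ‖q‖ ≤ 1) : ContinuousAt (quotVal h g) q :=
  ((continuous_evalLeft _).continuousAt.inv₀ (hp.evalLeft_symmetrization_ne_zero hq)).mul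
    (continuous_evalLeft _).continuousAt

/-- A power series `r` with `h * r = g` has the value `(h^{-*} * g)(q)` at `q`. -/
lemma IsInnerPair.seriesVal_eq_quotVal {h g : Polynomial ℍ} (hp : IsInnerPair h g)
    {r : PowerSeries ℍ} (hr : ConvergesOnBall r) (he : (h : PowerSeries ℍ) * r = g) {q : ℍ}
    (hq : ‖q‖ < 1) : seriesVal q r = quotVal h g q := by
  have h1 : ((symmetrization h : Polynomial ℍ) : PowerSeries ℍ) * r
      = ((regConj h * g : Polynomial ℍ) : PowerSeries ℍ) := by
    rw [← regConj_mul_self, Polynomial.coe_mul, Polynomial.coe_mul, mul_assoc, he]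
  have h2 := hasSum_coe_mul (symmetrization h) hr hq
  rw [h1] at h2
  have h3 := h2.unique (hasSum_coe _ q)
  rw [quotVal, ← h3, eq_inv_mul_iff_mul_eq₀ (hp.evalLeft_symmetrization_ne_zero hq.le),
    seriesVal, ← (hr.hasSum hq).summable.tsum_mul_left]
  refine tsum_congr fun n => ?_
  rw [← mul_assoc, ((evalLeft_symmetrization_commute q h).pow_left n).eq]

/-! ### Averages over roots of unity -/

lemma inner_mul_left_of_norm_one {u : ℍ} (hu : ‖u‖ = 1) (x y : ℍ) :
    inner ℝ (u * x) (u * y) = inner ℝ x y := by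
  have h (x y : ℍ) : (x * y).re = (y * x).re := by simp; ring
  have h1 : star u * u = 1 := by
    rw [Quaternion.star_mul_self, Quaternion.normSq_eq_norm_mul_self, hu]; simp
  rw [Quaternion.inner_def, Quaternion.inner_def, star_mul, ← mul_assoc, h, ← mul_assoc,
    ← mul_assoc, h1, one_mul]

/-- Parseval's identity for the discrete Fourier transform with quaternionic coefficients. -/
lemma sum_norm_sq_rootsOfUnity {M : ℕ} {ω : ℍ} (hM : ω ^ M = 1) (hn : ‖ω‖ = 1)
    (hω : ∀ d, 0 < d → d < M → ω ^ d ≠ 1) (c : ℕ → ℍ) :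
    ∑ k ∈ Finset.range M, ‖∑ n ∈ Finset.range M, (ω ^ k) ^ n * c n‖ ^ 2 =
      M * ∑ n ∈ Finset.range M, ‖c n‖ ^ 2 := by
  have key (n m : ℕ) (hn' : n < M) (hmn : m < n) :
      ∑ k ∈ Finset.range M, inner ℝ ((ω ^ k) ^ n * c n) ((ω ^ k) ^ m * c m) = 0 := by
    have e (k : ℕ) : inner ℝ ((ω ^ k) ^ n * c n) ((ω ^ k) ^ m * c m)
        = inner ℝ ((ω ^ (n - m)) ^ k * c n) (c m) := by
      rw [← inner_mul_left_of_norm_one (u := (ω ^ k) ^ m) (by simp [hn]) _ (c m), ← mul_assoc]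
      congr 2
      rw [← pow_mul, ← pow_mul, ← pow_mul, ← pow_add]
      congr 1
      rw [mul_comm (n - m), ← mul_add, Nat.add_sub_cancel' hmn.le]
    simp only [e]
    rw [← sum_inner, ← Finset.sum_mul]
    have h0 : ∑ k ∈ Finset.range M, (ω ^ (n - m)) ^ k = 0 := by
      have h1 := geom_sum_mul (ω ^ (n - m)) M
      rw [← pow_mul, mul_comm, pow_mul, hM, one_pow, sub_self] at h1
      exact (mul_eq_zero.1 h1).resolve_right (sub_ne_zero.2 (hω _ (by omega) (by omega)))
    rw [h0, zero_mul, inner_zero_left]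
  calc ∑ k ∈ Finset.range M, ‖∑ n ∈ Finset.range M, (ω ^ k) ^ n * c n‖ ^ 2
      = ∑ k ∈ Finset.range M, ∑ n ∈ Finset.range M, ∑ m ∈ Finset.range M,
          inner ℝ ((ω ^ k) ^ n * c n) ((ω ^ k) ^ m * c m) := by
        refine Finset.sum_congr rfl fun k _ => ?_
        rw [← real_inner_self_eq_norm_sq, sum_inner]
        simp only [inner_sum]
    _ = ∑ n ∈ Finset.range M, ∑ m ∈ Finset.range M, ∑ k ∈ Finset.range M,
          inner ℝ ((ω ^ k) ^ n * c n) ((ω ^ k) ^ m * c m) := by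
        rw [Finset.sum_comm]
        exact Finset.sum_congr rfl fun n _ => Finset.sum_comm
    _ = ∑ n ∈ Finset.range M, M * ‖c n‖ ^ 2 := by
        refine Finset.sum_congr rfl fun n hn' => ?_
        rw [Finset.sum_eq_single_of_mem n hn']
        · simp [norm_mul, hn]
        · intro m hm hmn
          rcases hmn.lt_or_gt with h | h
          · exact key n m (Finset.mem_range.1 hn') h
          · rw [← key m n (Finset.mem_range.1 hm) h]
            exact Finset.sum_congr rfl fun k _ => real_inner_comm _ _
    _ = _ := by rw [Finset.mul_sum]

lemma exists_primitive_root (M : ℕ) :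
    ∃ ω : ℍ, ‖ω‖ = 1 ∧ (0 < M → ω ^ M = 1) ∧ ∀ d, 0 < d → d < M → ω ^ d ≠ 1 := by
  rcases Nat.eq_zero_or_pos M with rfl | hM
  · exact ⟨1, norm_one, by simp, by omega⟩
  have hz := Complex.isPrimitiveRoot_exp M hM.ne'
  set z := Complex.exp (2 * Real.pi * Complex.I / M)
  have hω : (Quaternion.ofComplex z) ^ M = 1 := by rw [← map_pow, hz.pow_eq_one, map_one]
  refine ⟨Quaternion.ofComplex z, ?_, fun _ => hω, fun d h0 h1 h => ?_⟩
  · refine (pow_eq_one_iff_of_nonneg (norm_nonneg _) hM.ne').1 ?_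
    rw [← norm_pow, hω, norm_one]
  · rw [← map_pow, ← map_one Quaternion.ofComplex] at h
    exact hz.pow_ne_one_of_pos_of_lt h0.ne' h1 (Quaternion.ofComplex.toRingHom.injective h)

/-- A primitive root of unity of order `M` in `ℍ`. -/
noncomputable def rootOfUnity (M : ℕ) : ℍ := (exists_primitive_root M).choose

/-- The mean of `|r|²` over `M` equidistributed points of a circle of radius `ρ` in one slice. -/
noncomputable def meanSq (ρ : ℝ) (r : PowerSeries ℍ) (M : ℕ) : ℝ :=
  (M : ℝ)⁻¹ * ∑ k ∈ Finset.range M, ‖seriesVal ((ρ : ℍ) * rootOfUnity M ^ k) r‖ ^ 2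

lemma norm_coe_mul_rootOfUnity_pow {ρ : ℝ} (h0 : 0 ≤ ρ) (M k : ℕ) :
    ‖(ρ : ℍ) * rootOfUnity M ^ k‖ = ρ := by
  rw [norm_mul, norm_pow, rootOfUnity, (exists_primitive_root M).choose_spec.1, one_pow, mul_one,
    Quaternion.norm_coe, Real.norm_of_nonneg h0]

lemma summable_sq_of_nonneg {a : ℕ → ℝ} (hs : Summable a) (ha0 : ∀ n, 0 ≤ a n) :
    Summable fun n => a n ^ 2 := by
  refine .of_nonneg_of_le (fun n => by positivity) (fun n => ?_) (hs.mul_left (∑' n, a n))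
  rw [sq]
  exact mul_le_mul_of_nonneg_right (hs.le_tsum n fun m _ => ha0 m) (ha0 n)

/-- Parseval's identity as a limit of discrete means. -/
lemma tendsto_meanSq {r : PowerSeries ℍ} (hr : ConvergesOnBall r) {ρ : ℝ} (h0 : 0 ≤ ρ)
    (h1 : ρ < 1) :
    Tendsto (meanSq ρ r) atTop (𝓝 (∑' n, (ρ ^ n * ‖PowerSeries.coeff n r‖) ^ 2)) := by
  set a : ℕ → ℝ := fun n => ρ ^ n * ‖PowerSeries.coeff n r‖ with ha
  have hs : Summable a := hr ρ h0 h1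
  have ha0 (n : ℕ) : 0 ≤ a n := by positivity
  have hs2 := summable_sq_of_nonneg hs ha0
  set S := ∑' n, a n
  have hS : 0 ≤ S := tsum_nonneg ha0
  have htail : Tendsto (fun M => S - ∑ n ∈ Finset.range M, a n) atTop (𝓝 0) := by
    rw [← sub_self S]
    exact hs.hasSum.tendsto_sum_nat.const_sub S
  have hmain : Tendsto (fun M => ∑ n ∈ Finset.range M, a n ^ 2) atTop (𝓝 (∑' n, a n ^ 2)) :=
    hs2.hasSum.tendsto_sum_nat
  refine tendsto_of_tendsto_of_dist hmain
    (squeeze_zero' (Eventually.of_forall fun _ => dist_nonneg) ?_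
      (by simpa using htail.const_mul (2 * S)))
  filter_upwards [eventually_gt_atTop 0] with M hM
  obtain ⟨hω1, hω2, hω3⟩ := (exists_primitive_root M).choose_spec
  have hMR : (0 : ℝ) < M := by exact_mod_cast hM
  set q : ℕ → ℍ := fun k => (ρ : ℍ) * rootOfUnity M ^ k
  set P : ℕ → ℍ := fun k => ∑ n ∈ Finset.range M, q k ^ n * PowerSeries.coeff n r with hP
  have hq (k : ℕ) : ‖q k‖ = ρ := norm_coe_mul_rootOfUnity_pow h0 M k
  have hterm (k n : ℕ) : ‖q k ^ n * PowerSeries.coeff n r‖ = a n := by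
    rw [norm_mul, norm_pow, hq]
  -- The mean over the `M`-th roots of unity is exact for polynomials of degree less than `M`;
  -- the tail of the series is controlled by `hdiff`.
  have hpars : ∑ n ∈ Finset.range M, a n ^ 2 = (M : ℝ)⁻¹ * ∑ k ∈ Finset.range M, ‖P k‖ ^ 2 := by
    have := sum_norm_sq_rootsOfUnity (hω2 hM) hω1 hω3
      (fun n => (ρ : ℍ) ^ n * PowerSeries.coeff n r)
    have e (k n : ℕ) : ((exists_primitive_root M).choose ^ k) ^ n
        * ((ρ : ℍ) ^ n * PowerSeries.coeff n r) = q k ^ n * PowerSeries.coeff n r := by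
      have hc : Commute (ρ : ℍ) ((exists_primitive_root M).choose ^ k) :=
        Quaternion.coe_commutes ρ _
      rw [← mul_assoc, ← (hc.pow_pow n n).eq, ← hc.mul_pow]
      rfl
    simp only [e] at this
    rw [hP, this, inv_mul_cancel_left₀ hMR.ne']
    refine Finset.sum_congr rfl fun n _ => ?_
    rw [norm_mul, norm_pow, Quaternion.norm_coe, Real.norm_of_nonneg h0]
  have hdiff (k : ℕ) : |‖P k‖ ^ 2 - ‖seriesVal (q k) r‖ ^ 2|
      ≤ 2 * S * (S - ∑ n ∈ Finset.range M, a n) := by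
    have hsum := hr.hasSum (q := q k) (by rwa [hq])
    have b1 : ‖P k‖ ≤ S := (norm_sum_le _ _).trans (by
      simp only [hterm]
      exact hs.sum_le_tsum _ fun n _ => ha0 n)
    have b2 : ‖seriesVal (q k) r‖ ≤ S := tsum_of_norm_bounded hs.hasSum fun n => (hterm k n).le
    have b3 : ‖P k - seriesVal (q k) r‖ ≤ S - ∑ n ∈ Finset.range M, a n := by
      have e1 : seriesVal (q k) r - P k
          = ∑' n, q k ^ (n + M) * PowerSeries.coeff (n + M) r := by
        rw [sub_eq_iff_eq_add', seriesVal, hP]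
        exact (hsum.summable.sum_add_tsum_nat_add M).symm
      have e2 : S - ∑ n ∈ Finset.range M, a n = ∑' n, a (n + M) := by
        rw [sub_eq_iff_eq_add']
        exact (hs.sum_add_tsum_nat_add M).symm
      rw [norm_sub_rev, e1, e2]
      exact tsum_of_norm_bounded ((summable_nat_add_iff M).2 hs).hasSum
        fun n => (hterm k (n + M)).le
    have b4 := (abs_norm_sub_norm_le (P k) (seriesVal (q k) r)).trans b3
    rw [sq_sub_sq, abs_mul, abs_of_nonneg (by positivity)]
    exact mul_le_mul (by linarith) b4 (abs_nonneg _) (by positivity)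
  rw [Real.dist_eq, hpars, meanSq, ← mul_sub, ← Finset.sum_sub_distrib, abs_mul,
    abs_of_nonneg (by positivity), inv_mul_le_iff₀ hMR]
  refine (Finset.abs_sum_le_sum_abs _ _).trans ((Finset.sum_le_sum fun k _ => hdiff k).trans ?_)
  rw [Finset.sum_const, Finset.card_range, nsmul_eq_mul]

/-! ### Rational inner approximation of bounded scalar functions -/

/-- A pointwise bound of finitely many power series by a polynomial implies the same bound for
their `ℓ²`-norms. -/
lemma sum_partialSq_le {ι : Type*} [Fintype ι] {y : ι → PowerSeries ℍ}
    (hy : ∀ i, ConvergesOnBall (y i)) (p : Polynomial ℍ) {K : ℕ}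
    (hK : ∀ n, K ≤ n → p.coeff n = 0)
    (h : ∀ q : ℍ, ‖q‖ < 1 → ∑ i, ‖seriesVal q (y i)‖ ^ 2 ≤ ‖evalLeft q p‖ ^ 2) (N : ℕ) :
    ∑ i, partialSq (y i) N ≤ partialSq p K := by
  have hρ (ρ : ℝ) (h0 : 0 ≤ ρ) (h1 : ρ < 1) :
      ∑ i, ∑ n ∈ Finset.range N, (ρ ^ n * ‖PowerSeries.coeff n (y i)‖) ^ 2 ≤ partialSq p K := by
    have t1 := tendsto_finsetSum Finset.univ fun i _ => tendsto_meanSq (hy i) h0 h1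
    have t2 := tendsto_meanSq (convergesOnBall_coe p) h0 h1
    have t3 := le_of_tendsto_of_tendsto' t1 t2 fun M => by
      simp only [meanSq]
      rw [← Finset.mul_sum, Finset.sum_comm]
      refine mul_le_mul_of_nonneg_left (Finset.sum_le_sum fun k _ => ?_) (by positivity)
      rw [seriesVal_coe]
      exact h _ (by rwa [norm_coe_mul_rootOfUnity_pow h0])
    refine (Finset.sum_le_sum fun i _ => ?_).trans (t3.trans ?_)
    · exact (summable_sq_of_nonneg (hy i ρ h0 h1) fun n => by positivity).sum_le_tsum _
        fun n _ => by positivity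
    · rw [tsum_eq_sum (s := Finset.range K)]
      · refine Finset.sum_le_sum fun n _ => ?_
        gcongr
        exact mul_le_of_le_one_left (norm_nonneg _) (pow_le_one₀ h0 h1.le)
      · intro n hn
        rw [Polynomial.coeff_coe, hK n (by simpa using hn)]
        simp
  have hlim : Tendsto
      (fun ρ : ℝ => ∑ i, ∑ n ∈ Finset.range N, (ρ ^ n * ‖PowerSeries.coeff n (y i)‖) ^ 2)
      (𝓝[<] 1) (𝓝 (∑ i, partialSq (y i) N)) := by
    have hc : Continuous
        (fun ρ : ℝ => ∑ i, ∑ n ∈ Finset.range N, (ρ ^ n * ‖PowerSeries.coeff n (y i)‖) ^ 2) := by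
      fun_prop
    have := (hc.tendsto 1).mono_left (nhdsWithin_le_nhds (s := Set.Iio 1))
    simpa [partialSq] using this
  refine le_of_tendsto hlim ?_
  filter_upwards [Ioo_mem_nhdsLT (zero_lt_one' ℝ)] with ρ hρ'
  exact hρ ρ hρ'.1.le hρ'.2

/-- A power series bounded by one on the ball belongs to the Schur class. -/
lemma isSchur_of_norm_seriesVal_le_one {f : PowerSeries ℍ} (hf : ConvergesOnBall f)
    (h1 : ∀ q : ℍ, ‖q‖ < 1 → ‖seriesVal q f‖ ≤ 1) : IsSchur f := by
  intro g N
  -- Only the first `N` coefficients of `g` matter, so `g` may be replaced by its truncation.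
  set p := PowerSeries.trunc N g with hp
  have hgp : ∀ n < N, PowerSeries.coeff n g = PowerSeries.coeff n (p : PowerSeries ℍ) :=
    fun n hn => by rw [Polynomial.coeff_coe, hp, PowerSeries.coeff_trunc, if_pos hn]
  have e1 : partialSq (g * f) N = partialSq (p * f) N := by
    refine partialSq_congr fun n hn => ?_
    rw [PowerSeries.coeff_mul, PowerSeries.coeff_mul]
    refine Finset.sum_congr rfl fun x hx => ?_
    rw [hgp _ ((Finset.HasAntidiagonal.antidiagonal.fst_le hx).trans_lt hn)]
  have := sum_partialSq_le (ι := Unit) (y := fun _ => (p : PowerSeries ℍ) * f)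
    (fun _ => convergesOnBall_coe_mul p hf) p (K := N)
    (fun n hn => by rw [hp, PowerSeries.coeff_trunc, if_neg hn.not_gt])
    (fun q hq => by
      simp only [Finset.univ_unique, Finset.sum_singleton]
      gcongr
      exact norm_seriesVal_coe_mul_le p hf h1 hq) N
  rw [e1, partialSq_congr hgp]
  simpa using this

/-- Scalar rational inner approximation: a function bounded by one agrees with a rational inner
function up to order `N`, and hence up to `2 |q|^N / (1 - |q|)`. -/
lemma exists_isInnerPair_norm_sub_le {f : PowerSeries ℍ} (hf : ConvergesOnBall f)
    (h1 : ∀ q : ℍ, ‖q‖ < 1 → ‖seriesVal q f‖ ≤ 1) (N : ℕ) :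
    ∃ h g : Polynomial ℍ, IsInnerPair h g ∧ ∀ q : ℍ, ‖q‖ < 1 →
      ‖seriesVal q f - quotVal h g q‖ ≤ 2 * ‖q‖ ^ N * (1 - ‖q‖)⁻¹ := by
  have hS := isSchur_of_norm_seriesVal_le_one hf h1
  obtain ⟨h, g, r, hp, hr, he, hc⟩ := hS.exists_inner_pair N
  refine ⟨h, g, hp, fun q hq => ?_⟩
  rw [← hp.seriesVal_eq_quotVal hr.convergesOnBall he hq]
  have hs := (hf.hasSum hq).sub (hr.convergesOnBall.hasSum hq)
  rw [← hs.tsum_eq, ← hs.summable.sum_add_tsum_nat_add N, Finset.sum_eq_zero, zero_add]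
  · refine tsum_of_norm_bounded
      ((hasSum_geometric_of_lt_one (norm_nonneg q) hq).mul_left (2 * ‖q‖ ^ N)) fun n => ?_
    rw [← mul_sub, norm_mul, norm_pow]
    have b : ‖PowerSeries.coeff (n + N) f - PowerSeries.coeff (n + N) r‖ ≤ 2 :=
      (norm_sub_le _ _).trans (by
        linarith [hS.norm_coeff_le_one (n + N), hr.norm_coeff_le_one (n + N)])
    calc ‖q‖ ^ (n + N) * _ ≤ ‖q‖ ^ (n + N) * 2 := by gcongr
      _ = 2 * ‖q‖ ^ N * ‖q‖ ^ n := by ring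
  · intro n hn
    rw [hc n (Finset.mem_range.1 hn), sub_self]

/-! ### Quaternionic matrices and the operator norm -/

/-- The squared Euclidean norm of a quaternionic vector. -/
noncomputable def vecSq {n : ℕ} (x : Fin n → ℍ) : ℝ := ∑ i, ‖x i‖ ^ 2

lemma vecSq_nonneg {n : ℕ} (x : Fin n → ℍ) : 0 ≤ vecSq x :=
  Finset.sum_nonneg fun _ _ => by positivity

lemma norm_toLp_eq {n : ℕ} (x : Fin n → ℍ) : ‖WithLp.toLp 2 x‖ = √(vecSq x) := by
  rw [← Real.sqrt_sq (norm_nonneg (WithLp.toLp 2 x)), PiLp.norm_sq_eq_of_L2]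
  rfl

lemma vecSq_pos {n : ℕ} {x : Fin n → ℍ} (hx : x ≠ 0) : 0 < vecSq x := by
  obtain ⟨i, hi⟩ := Function.ne_iff.1 hx
  have : 0 < ‖x i‖ ^ 2 := by
    have := norm_pos_iff.2 hi
    positivity
  exact this.trans_le (Finset.single_le_sum (f := fun i => ‖x i‖ ^ 2)
    (fun _ _ => by positivity) (Finset.mem_univ i))

lemma vecSq_smul {n : ℕ} (c : ℝ) (x : Fin n → ℍ) : vecSq (c • x) = c ^ 2 * vecSq x := by
  simp [vecSq, norm_smul, mul_pow, Finset.mul_sum]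

lemma star_dotProduct_self {n : ℕ} (x : Fin n → ℍ) : star x ⬝ᵥ x = ((vecSq x : ℝ) : ℍ) := by
  have h (z : ℍ) : star z * z = ((‖z‖ ^ 2 : ℝ) : ℍ) := by
    rw [Quaternion.star_mul_self, Quaternion.normSq_eq_norm_mul_self, sq]
  simp only [dotProduct, Pi.star_apply, h, vecSq]
  exact (map_sum (algebraMap ℝ ℍ) _ _).symm

lemma vecSq_mulVec_of_mem_unitary {n : ℕ} {W : Matrix (Fin n) (Fin n) ℍ}
    (hW : W ∈ unitary (Matrix (Fin n) (Fin n) ℍ)) (x : Fin n → ℍ) :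
    vecSq (W.mulVec x) = vecSq x := by
  refine Quaternion.coe_injective ?_
  rw [← star_dotProduct_self, ← star_dotProduct_self, Matrix.star_mulVec, Matrix.dotProduct_mulVec,
    Matrix.vecMul_vecMul, ← Matrix.star_eq_conjTranspose, (Unitary.mem_iff.1 hW).1,
    Matrix.vecMul_one]

lemma opNorm_le {n : ℕ} {A : Matrix (Fin n) (Fin n) ℍ} {c : ℝ} (hc : 0 ≤ c)
    (h : ∀ x, vecSq (A.mulVec x) ≤ c ^ 2 * vecSq x) : opNorm A ≤ c := by
  refine Real.sSup_le ?_ hc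
  rintro t ⟨x, hx, rfl⟩
  rw [norm_toLp_eq, norm_toLp_eq, div_le_iff₀ (Real.sqrt_pos.2 (vecSq_pos hx)),
    ← Real.sqrt_sq hc, ← Real.sqrt_mul (sq_nonneg c)]
  exact Real.sqrt_le_sqrt (h x)

lemma vecSq_mulVec_le_of_opNorm_eq_one {n : ℕ} {A : Matrix (Fin n) (Fin n) ℍ}
    (hA : opNorm A = 1) (x : Fin n → ℍ) : vecSq (A.mulVec x) ≤ vecSq x := by
  by_cases hx : x = 0
  · simp [hx, vecSq]
  -- The supremum of an unbounded set of reals would be `0`.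
  have hb : BddAbove {t : ℝ | ∃ x : Fin n → ℍ, x ≠ 0 ∧
      t = ‖WithLp.toLp 2 (A.mulVec x)‖ / ‖WithLp.toLp 2 x‖} := by
    by_contra hb
    rw [opNorm, Real.sSup_of_not_bddAbove hb] at hA
    exact zero_ne_one hA
  have h1 := le_csSup hb ⟨x, hx, rfl⟩
  rw [← opNorm, hA, norm_toLp_eq, norm_toLp_eq, div_le_one (Real.sqrt_pos.2 (vecSq_pos hx))] at h1
  exact (Real.sqrt_le_sqrt_iff (vecSq_nonneg x)).1 h1

lemma continuous_vecSq {n : ℕ} : Continuous (vecSq : (Fin n → ℍ) → ℝ) := by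
  unfold vecSq
  fun_prop

/-- The operator norm is attained. -/
lemma exists_vecSq_mulVec_eq_one {n : ℕ} {A : Matrix (Fin n) (Fin n) ℍ} (hA : opNorm A = 1) :
    ∃ x : Fin n → ℍ, vecSq x = 1 ∧ vecSq (A.mulVec x) = 1 := by
  have hcomp : IsCompact {x : Fin n → ℍ | vecSq x = 1} := by
    refine Metric.isCompact_of_isClosed_isBounded
      (isClosed_eq continuous_vecSq continuous_const) ?_
    refine (Metric.isBounded_closedBall (x := (0 : Fin n → ℍ)) (r := 1)).subset fun x hx => ?_
    rw [mem_closedBall_zero_iff, pi_norm_le_iff_of_nonneg zero_le_one]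
    intro i
    have h1 : ‖x i‖ ^ 2 ≤ vecSq x := Finset.single_le_sum (f := fun i => ‖x i‖ ^ 2)
      (fun _ _ => by positivity) (Finset.mem_univ i)
    exact (sq_le_one_iff₀ (norm_nonneg _)).1 (h1.trans (le_of_eq hx))
  have hscale (x : Fin n → ℍ) (hx : x ≠ 0) :
      vecSq ((√(vecSq x))⁻¹ • x) = 1 ∧
        vecSq (A.mulVec x) = vecSq x * vecSq (A.mulVec ((√(vecSq x))⁻¹ • x)) := by
    have := vecSq_pos hx
    rw [Matrix.mulVec_smul, vecSq_smul, vecSq_smul, inv_pow, Real.sq_sqrt this.le]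
    constructor <;> field_simp
  have hne : {x : Fin n → ℍ | vecSq x = 1}.Nonempty := by
    by_contra hne
    have : opNorm A ≤ 0 := opNorm_le le_rfl fun x => by
      by_cases hx : x = 0
      · simp [hx, vecSq]
      · exact absurd ⟨_, (hscale x hx).1⟩ hne
    linarith
  have hcont : Continuous fun x : Fin n → ℍ => vecSq (A.mulVec x) :=
    continuous_vecSq.comp (continuous_const.matrix_mulVec continuous_id)
  obtain ⟨x, hx, hmax⟩ := hcomp.exists_isMaxOn hne hcont.continuousOn
  refine ⟨x, hx, le_antisymm ?_ ?_⟩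
  · exact (vecSq_mulVec_le_of_opNorm_eq_one hA x).trans hx.le
  · have h1 : opNorm A ≤ √(vecSq (A.mulVec x)) := opNorm_le (Real.sqrt_nonneg _) fun y => by
      rw [Real.sq_sqrt (vecSq_nonneg _)]
      by_cases hy : y = 0
      · simp [hy, vecSq]
      · rw [(hscale y hy).2, mul_comm]
        exact mul_le_mul_of_nonneg_right (hmax (hscale y hy).1) (vecSq_nonneg y)
    rw [hA, Real.one_le_sqrt] at h1
    exact h1

/-- Every unit vector of `ℍ²` is the first column of a unitary matrix. -/
lemma exists_unitary_col_eq {x : Fin 2 → ℍ} (hx : vecSq x = 1) :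
    ∃ W ∈ unitary (Matrix (Fin 2) (Fin 2) ℍ), W.col 0 = x := by
  obtain ⟨e, he, hxe⟩ : ∃ e : ℍ, ‖e‖ = 1 ∧ x 0 = e * (‖x 0‖ : ℝ) := by
    by_cases h0 : x 0 = 0
    · exact ⟨1, norm_one, by simp [h0]⟩
    · have hn : ‖x 0‖ ≠ 0 := norm_ne_zero_iff.2 h0
      refine ⟨x 0 * ((‖x 0‖⁻¹ : ℝ) : ℍ), ?_, ?_⟩
      · rw [norm_mul, Quaternion.norm_coe, norm_inv, norm_norm, mul_inv_cancel₀ hn]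
      · rw [mul_assoc, ← Quaternion.coe_mul, inv_mul_cancel₀ hn, Quaternion.coe_one, mul_one]
  have hsq (z : ℍ) : star z * z = ((‖z‖ ^ 2 : ℝ) : ℍ) ∧ z * star z = ((‖z‖ ^ 2 : ℝ) : ℍ) := by
    rw [Quaternion.star_mul_self, Quaternion.self_mul_star, Quaternion.normSq_eq_norm_mul_self, sq]
    exact ⟨rfl, rfl⟩
  set ρ := ‖x 0‖
  set y := x 1
  have hρy : ρ ^ 2 + ‖y‖ ^ 2 = 1 := by simpa [vecSq, Fin.sum_univ_two] using hx
  have e1 : star e * e = 1 := by rw [(hsq e).1, he]; simp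
  have e2 : e * star e = 1 := by rw [(hsq e).2, he]; simp
  have y1 := (hsq y).1
  have y2 := (hsq y).2
  have hr (z : ℍ) : (ρ : ℍ) * z = z * (ρ : ℍ) := Quaternion.coe_commutes ρ z
  have hY (z : ℍ) : ((‖y‖ ^ 2 : ℝ) : ℍ) * z = z * ((‖y‖ ^ 2 : ℝ) : ℍ) :=
    Quaternion.coe_commutes _ z
  have hone : (ρ : ℍ) * (ρ : ℍ) + ((‖y‖ ^ 2 : ℝ) : ℍ) = 1 := by
    rw [← Quaternion.coe_mul, ← Quaternion.coe_add, ← sq, hρy, Quaternion.coe_one]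
  refine ⟨!![e * ρ, -(e * star y); y, (ρ : ℍ)], Unitary.mem_iff.2 ⟨?_, ?_⟩, ?_⟩
  · ext1 i j
    fin_cases i <;> fin_cases j <;>
      simp [Matrix.mul_apply, Fin.sum_univ_two, Matrix.star_apply]
    · rw [mul_assoc, ← mul_assoc (star e), e1, one_mul, y1, hone]
    · rw [mul_assoc, ← mul_assoc (star e), e1, one_mul, hr, neg_add_cancel]
    · rw [mul_assoc, ← mul_assoc (star e), e1, one_mul, hr, neg_add_cancel]
    · rw [mul_assoc, ← mul_assoc (star e), e1, one_mul, y2, add_comm, hone]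
  · ext1 i j
    fin_cases i <;> fin_cases j <;>
      simp [Matrix.mul_apply, Fin.sum_univ_two, Matrix.star_apply]
    · rw [mul_assoc, ← mul_assoc (ρ : ℍ), mul_assoc e (star y), ← mul_assoc (star y), y1,
        ← mul_add, ← add_mul, hone, one_mul, e2]
    · rw [mul_assoc, hr, mul_assoc, add_neg_cancel]
    · rw [hr, hr, mul_assoc, add_neg_cancel]
    · rw [y2, add_comm, hone]
  · ext1 i
    fin_cases i
    · simpa using hxe.symm
    · rfl

/-! ### Two rigidity lemmas -/

/-- A power series with bounded quaternionic coefficients which vanishes for all real arguments in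
`(0, 1)` has zero coefficients. -/
lemma eq_zero_of_hasSum_smul_zero {c : ℕ → ℍ} {B : ℝ} (hB : ∀ n, ‖c n‖ ≤ B)
    (h : ∀ t : ℝ, 0 < t → t < 1 → HasSum (fun n => t ^ n • c n) 0) (n : ℕ) : c n = 0 := by
  induction n using Nat.strong_induction_on with
  | _ n ih =>
    have hbound (t : ℝ) (h0 : 0 < t) (h1 : t < 1) : ‖c n‖ ≤ t * (B * (1 - t)⁻¹) := by
      have hs := h t h0 h1
      have e1 := hs.summable.sum_add_tsum_nat_add n
      rw [hs.tsum_eq, Finset.sum_eq_zero, zero_add] at e1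
      · have hs' := (summable_nat_add_iff n).2 hs.summable
        have e2 : ∑' k, t ^ k • c (k + n) = 0 := by
          have e3 : t ^ n • ∑' k, t ^ k • c (k + n) = 0 := by
            rw [← e1, ← tsum_const_smul'' (t ^ n)]
            refine tsum_congr fun k => ?_
            rw [smul_smul, ← pow_add, add_comm]
          exact (smul_eq_zero.1 e3).resolve_left (pow_pos h0 n).ne'
        have hg := summable_geometric_of_lt_one h0.le h1
        have hs2 : Summable fun k => t ^ k • c (k + n) := by
          refine .of_norm_bounded (hg.mul_right B) fun k => ?_
          rw [norm_smul, Real.norm_of_nonneg (pow_nonneg h0.le k)]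
          gcongr
          exact hB _
        rw [hs2.tsum_eq_zero_add, pow_zero, one_smul, zero_add] at e2
        rw [eq_neg_of_add_eq_zero_left e2, norm_neg]
        refine tsum_of_norm_bounded
          (((hasSum_geometric_of_lt_one h0.le h1).mul_left B).mul_left t) fun k => ?_
        rw [norm_smul, Real.norm_of_nonneg (pow_nonneg h0.le _), pow_succ]
        calc t ^ k * t * ‖c (k + 1 + n)‖ ≤ t ^ k * t * B := by
              gcongr
              exact hB _
          _ = t * (B * t ^ k) := by ring
      · intro k hk
        rw [ih k (Finset.mem_range.1 hk), smul_zero]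
    have hlim : Tendsto (fun t : ℝ => t * (B * (1 - t)⁻¹)) (𝓝[>] 0) (𝓝 0) := by
      have hc : ContinuousAt (fun t : ℝ => t * (B * (1 - t)⁻¹)) 0 := by
        refine continuousAt_id.mul (continuousAt_const.mul (ContinuousAt.inv₀ ?_ (by simp)))
        fun_prop
      simpa using hc.tendsto.mono_left (nhdsWithin_le_nhds (s := Set.Ioi 0))
    have : ‖c n‖ ≤ 0 := by
      refine ge_of_tendsto hlim ?_
      filter_upwards [Ioo_mem_nhdsGT (zero_lt_one' ℝ)] with t ht
      exact hbound t ht.1 ht.2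
    exact norm_le_zero_iff.1 this

/-- If `c` commutes with the `n`-th powers of all unit quaternions, then `c` is real: both `i`
and `j` are such powers. -/
lemma eq_coe_re_of_commute_pow {c : ℍ} {n : ℕ} (hn : n ≠ 0)
    (h : ∀ J : ℍ, ‖J‖ = 1 → J ^ n * c = c * J ^ n) : c = (c.re : ℍ) := by
  obtain ⟨z, hz⟩ := IsAlgClosed.exists_pow_nat_eq Complex.I (Nat.pos_of_ne_zero hn)
  set J := Quaternion.ofComplex z
  have hJ : J ^ n = Quaternion.ofComplex Complex.I := by rw [← map_pow, hz]
  have hI : ‖Quaternion.ofComplex Complex.I‖ = 1 := by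
    refine (pow_eq_one_iff_of_nonneg (norm_nonneg _) (four_ne_zero)).1 ?_
    rw [← norm_pow, ← map_pow, Complex.I_pow_four, map_one, norm_one]
  have hJn : ‖J‖ = 1 := by
    refine (pow_eq_one_iff_of_nonneg (norm_nonneg _) hn).1 ?_
    rw [← norm_pow, hJ, hI]
  -- Conjugation by `p = 1 - k` turns `i` into `j`.
  obtain ⟨p, p1, p2, p3, p4⟩ : ∃ p : ℍ, p.re = 1 ∧ p.imI = 0 ∧ p.imJ = 0 ∧ p.imK = -1 :=
    ⟨⟨1, 0, 0, -1⟩, rfl, rfl, rfl, rfl⟩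
  have hp : p ≠ 0 := fun h0 => by
    have := congrArg QuaternionAlgebra.re h0
    simp [p1] at this
  have h1 := h J hJn
  have h2 := h (p⁻¹ * J * p) (by rw [norm_conj p J hp, hJn])
  have e : (p⁻¹ * J * p) ^ n = p⁻¹ * J ^ n * p := by
    rw [← inv_mul_cancel_left₀ hp ((p⁻¹ * J * p) ^ n), mul_conj_pow p J hp, mul_assoc]
  obtain ⟨j, j1, j2, j3, j4⟩ : ∃ j : ℍ, j.re = 0 ∧ j.imI = 0 ∧ j.imJ = 1 ∧ j.imK = 0 :=
    ⟨⟨0, 0, 1, 0⟩, rfl, rfl, rfl, rfl⟩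
  have h3 : Quaternion.ofComplex Complex.I * p = p * j := by
    rw [Quaternion.coe_ofComplex]
    ext <;> simp [p1, p2, p3, p4, j1, j2, j3, j4]
  rw [e, hJ, mul_assoc p⁻¹, h3, inv_mul_cancel_left₀ hp] at h2
  rw [hJ, Quaternion.coe_ofComplex] at h1
  have a1 := congrArg QuaternionAlgebra.imJ h1
  have a2 := congrArg QuaternionAlgebra.imK h1
  have a3 := congrArg QuaternionAlgebra.imI h2
  have a4 := congrArg QuaternionAlgebra.imK h2
  simp [j1, j2, j3, j4] at a1 a2 a3 a4
  ext <;> simp <;> linarith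

/-- A unit vector `v` for which `v̄₀ Jⁿ w₀ + v̄₁ Jⁿ w₁ = 0` holds for all unit quaternions `J`, with
some `w ≠ 0` and `n ≠ 0`, is a real unit vector up to a scalar factor on the right. -/
lemma exists_real_vector {v : Fin 2 → ℍ} (hv : vecSq v = 1) {w : Fin 2 → ℍ} (hw : w ≠ 0) {n : ℕ}
    (hn : n ≠ 0)
    (h : ∀ J : ℍ, ‖J‖ = 1 → star (v 0) * J ^ n * w 0 + star (v 1) * J ^ n * w 1 = 0) :
    ∃ a b : ℝ, ∃ s : ℍ, a ^ 2 + b ^ 2 = 1 ∧ ‖s‖ = 1 ∧ v 0 = a * s ∧ v 1 = b * s := by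
  rw [vecSq, Fin.sum_univ_two] at hv
  by_cases h0 : v 0 = 0
  · refine ⟨0, 1, v 1, by norm_num, ?_, by simp [h0], by simp⟩
    rw [h0, norm_zero] at hv
    exact (pow_eq_one_iff_of_nonneg (norm_nonneg _) two_ne_zero).1 (by linarith)
  have h0' : star (v 0) ≠ 0 := star_ne_zero.2 h0
  set c := (star (v 0))⁻¹ * star (v 1) with hc
  have hv1 : star (v 1) = star (v 0) * c := by rw [hc, mul_inv_cancel_left₀ h0']
  have hJ (J : ℍ) (hJ : ‖J‖ = 1) : J ^ n * w 0 + c * J ^ n * w 1 = 0 := by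
    have := h J hJ
    rw [hv1, mul_assoc, mul_assoc, mul_assoc, ← mul_add, ← mul_assoc] at this
    simpa [mul_assoc, h0] using this
  have hw0 : w 0 = -(c * w 1) := by
    have := hJ 1 norm_one
    rw [one_pow, one_mul, mul_one] at this
    exact eq_neg_of_add_eq_zero_left this
  have hw1 : w 1 ≠ 0 := fun h1 => hw <| by
    ext1 i
    fin_cases i
    · simp [hw0, h1]
    · exact h1
  have hcr : c = (c.re : ℍ) := eq_coe_re_of_commute_pow hn fun J hJ1 => by
    refine mul_right_cancel₀ hw1 ?_
    have := hJ J hJ1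
    rw [hw0, mul_neg, neg_add_eq_zero] at this
    rw [mul_assoc, this]
  set t := c.re
  have hvt : v 1 = (t : ℍ) * v 0 := by
    have := congrArg star hv1
    rwa [star_star, star_mul, star_star, hcr, Quaternion.star_coe] at this
  have hpos : 0 < 1 + t ^ 2 := by positivity
  have hsq := Real.sq_sqrt hpos.le
  have hspos := Real.sqrt_pos.2 hpos
  set d := √(1 + t ^ 2)
  have hnorm : ‖v 0‖ ^ 2 * d ^ 2 = 1 := by
    rw [hvt, norm_mul, Quaternion.norm_coe, mul_pow, Real.norm_eq_abs, sq_abs] at hv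
    rw [hsq]; linarith
  refine ⟨d⁻¹, d⁻¹ * t, d * v 0, ?_, ?_, ?_, ?_⟩
  · field_simp
    linarith
  · refine (pow_eq_one_iff_of_nonneg (norm_nonneg _) two_ne_zero).1 ?_
    rw [norm_mul, Quaternion.norm_coe, mul_pow, Real.norm_eq_abs, sq_abs, mul_comm, hnorm]
  · rw [← mul_assoc, ← Quaternion.coe_mul, inv_mul_cancel₀ hspos.ne', Quaternion.coe_one, one_mul]
  · rw [← mul_assoc, ← Quaternion.coe_mul, mul_right_comm, inv_mul_cancel₀ hspos.ne', one_mul, hvt]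

/-! ### Factorization of functions of constant norm -/

/-- Power series of the entries of a regular matrix function. -/
lemma IsRegularMatrix.exists_series {n : ℕ} {F : ℍ → Matrix (Fin n) (Fin n) ℍ}
    (hF : IsRegularMatrix F) :
    ∃ A : Fin n → Fin n → PowerSeries ℍ, ∀ i j, ∀ q : ℍ, ‖q‖ < 1 →
      HasSum (fun k => q ^ k * PowerSeries.coeff k (A i j)) (F q i j) := by
  choose a _ ha using hF
  refine ⟨fun i j => PowerSeries.mk (a i j), fun i j q hq => ?_⟩
  simpa using ha i j q (by simpa [unitBall] using hq)

/-- The power series of the vector function `q ↦ F(q) x`. -/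
lemma IsRegularMatrix.exists_series_mulVec {n : ℕ} {F : ℍ → Matrix (Fin n) (Fin n) ℍ}
    (hF : IsRegularMatrix F) (x : Fin n → ℍ) :
    ∃ y : Fin n → PowerSeries ℍ, (∀ i, ConvergesOnBall (y i)) ∧
      ∀ q : ℍ, ‖q‖ < 1 → ∀ i, seriesVal q (y i) = (F q).mulVec x i := by
  obtain ⟨A, hA⟩ := hF.exists_series
  have key (i : Fin n) (q : ℍ) (hq : ‖q‖ < 1) :
      HasSum (fun k => q ^ k * PowerSeries.coeff k (∑ j, A i j * PowerSeries.C (x j)))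
        ((F q).mulVec x i) := by
    have := hasSum_sum (s := Finset.univ) fun j _ => (hA i j q hq).mul_right (x j)
    simpa only [map_sum, PowerSeries.coeff_mul_C, Finset.mul_sum, mul_assoc, Matrix.mulVec,
      dotProduct] using this
  exact ⟨fun i => ∑ j, A i j * PowerSeries.C (x j),
    fun i => convergesOnBall_of_summable fun q hq => (key i q hq).summable,
    fun q hq i => (key i q hq).tsum_eq⟩

lemma seriesVal_zero (r : PowerSeries ℍ) : seriesVal 0 r = PowerSeries.coeff 0 r := by
  rw [seriesVal, tsum_eq_single 0]
  · simp
  · intro n hn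
    rw [zero_pow hn, zero_mul]

/-- Bessel's inequality for a vector-valued power series bounded by one. -/
lemma sum_partialSq_le_one {ι : Type*} [Fintype ι] {y : ι → PowerSeries ℍ}
    (hy : ∀ i, ConvergesOnBall (y i))
    (h : ∀ q : ℍ, ‖q‖ < 1 → ∑ i, ‖seriesVal q (y i)‖ ^ 2 ≤ 1) (N : ℕ) :
    ∑ i, partialSq (y i) N ≤ 1 := by
  have := sum_partialSq_le hy (C 1) (K := 1)
    (fun n hn => by rw [coeff_C, if_neg (by omega)])
    (fun q hq => by simpa only [evalLeft_C, norm_one, one_pow] using h q hq) N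
  refine this.trans (le_of_eq ?_)
  simp [partialSq]

/-- A maximum principle: a vector-valued power series bounded by one, whose value at the origin
has norm one, is constant. -/
lemma coeff_eq_zero_of_maximum {ι : Type*} [Fintype ι] {y : ι → PowerSeries ℍ}
    (hy : ∀ i, ConvergesOnBall (y i))
    (h : ∀ q : ℍ, ‖q‖ < 1 → ∑ i, ‖seriesVal q (y i)‖ ^ 2 ≤ 1)
    (h0 : ∑ i, ‖seriesVal 0 (y i)‖ ^ 2 = 1) (i : ι) {n : ℕ} (hn : n ≠ 0) :
    PowerSeries.coeff n (y i) = 0 := by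
  obtain ⟨m, rfl⟩ := Nat.exists_eq_succ_of_ne_zero hn
  have h1 := sum_partialSq_le_one hy h (m + 2)
  simp only [seriesVal_zero] at h0
  have h2 : ∑ i, (‖PowerSeries.coeff 0 (y i)‖ ^ 2 + ‖PowerSeries.coeff (m + 1) (y i)‖ ^ 2)
      ≤ ∑ i, partialSq (y i) (m + 2) := by
    refine Finset.sum_le_sum fun j _ => ?_
    rw [partialSq, Finset.sum_range_succ', Finset.sum_range_succ, add_comm]
    gcongr
    exact le_add_of_nonneg_left (by positivity)
  rw [Finset.sum_add_distrib, h0] at h2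
  have h3 : ‖PowerSeries.coeff (m + 1) (y i)‖ ^ 2
      ≤ ∑ i, ‖PowerSeries.coeff (m + 1) (y i)‖ ^ 2 :=
    Finset.single_le_sum (f := fun i => ‖PowerSeries.coeff (m + 1) (y i)‖ ^ 2)
      (fun _ _ => by positivity) (Finset.mem_univ i)
  have h4 : ‖PowerSeries.coeff (m + 1) (y i)‖ ^ 2 = 0 := le_antisymm (by linarith) (by positivity)
  simpa using h4

/-- If `v` is a unit vector and the matrix with columns `v, u` is a contraction, then `v ⟂ u`. -/
lemma star_dotProduct_eq_zero_of_contraction {v u : Fin 2 → ℍ} (hv : vecSq v = 1)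
    (h : ∀ α : ℍ, vecSq (fun i => v i * α + u i) ≤ ‖α‖ ^ 2 + 1) :
    star (v 0) * u 0 + star (v 1) * u 1 = 0 := by
  set p := star (v 0) * u 0 + star (v 1) * u 1 with hp
  by_contra hne
  have hpos : 0 < ‖p‖ ^ 2 := by
    have := norm_pos_iff.2 hne
    positivity
  have hn (z : ℍ) : ‖z‖ ^ 2 = Quaternion.normSq z := by
    rw [Quaternion.normSq_eq_norm_mul_self, sq]
  have hrc (x y : ℍ) : (x * y).re = (y * x).re := by simp; ring
  have key (t : ℝ) : vecSq (fun i => v i * (p * (t : ℍ)) + u i)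
      = t ^ 2 * ‖p‖ ^ 2 + vecSq u + 2 * t * ‖p‖ ^ 2 := by
    have hcross (i : Fin 2) : (v i * (p * (t : ℍ)) * star (u i)).re
        = t * (p * star (star (v i) * u i)).re := by
      rw [star_mul, star_star, ← Quaternion.coe_commutes, ← mul_assoc, ← Quaternion.coe_commutes,
        mul_assoc, mul_assoc, Quaternion.coe_mul_eq_smul, Quaternion.re_smul, smul_eq_mul,
        hrc, mul_assoc]
    have hsum : (p * star (star (v 0) * u 0)).re + (p * star (star (v 1) * u 1)).re = ‖p‖ ^ 2 := by
      rw [← Quaternion.re_add, ← mul_add, ← star_add, ← hp, hn, Quaternion.normSq_def]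
    simp only [vecSq, Fin.sum_univ_two, hn] at hv hsum ⊢
    rw [Quaternion.normSq_add, Quaternion.normSq_add, hcross, hcross]
    simp only [map_mul, Quaternion.normSq_coe]
    linear_combination (Quaternion.normSq p * t ^ 2) * hv + 2 * t * hsum
  -- The cross term is linear in `t` and the quadratic terms cancel; any `t > 1 / (2 |p|²)` gives
  -- a contradiction.
  have h1 := h (p * ((‖p‖ ^ 2)⁻¹ : ℝ))
  rw [key, norm_mul, Quaternion.norm_coe, mul_pow, Real.norm_eq_abs, sq_abs, mul_assoc 2,
    inv_mul_cancel₀ hpos.ne'] at h1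
  have := vecSq_nonneg u
  linarith

/-- A non-constant regular function with `‖F‖ = 1` on the ball has the form
`F = O diag(s, f) W*`, with a real rotation `O`, a unitary `W`, a constant `s` of modulus one and a
scalar regular function `f` bounded by one. -/
lemma exists_factorization {F : ℍ → Matrix (Fin 2) (Fin 2) ℍ} (hreg : IsRegularMatrix F)
    (hnorm : ∀ q ∈ unitBall, opNorm (F q) = 1)
    (hnonconst : ∃ p ∈ unitBall, ∃ q ∈ unitBall, F p ≠ F q) :
    ∃ W ∈ unitary (Matrix (Fin 2) (Fin 2) ℍ), ∃ a b : ℝ, ∃ s : ℍ, ∃ f : PowerSeries ℍ,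
      a ^ 2 + b ^ 2 = 1 ∧ ‖s‖ = 1 ∧ ConvergesOnBall f ∧ (∀ q : ℍ, ‖q‖ < 1 → ‖seriesVal q f‖ ≤ 1) ∧
      ∀ q : ℍ, ‖q‖ < 1 →
        F q = !![(a : ℍ), -b; (b : ℍ), a] * !![s, 0; 0, seriesVal q f] * star W := by
  have hball {q : ℍ} : q ∈ unitBall ↔ ‖q‖ < 1 := by simp [unitBall]
  have hcontr (q : ℍ) (hq : ‖q‖ < 1) (x : Fin 2 → ℍ) : vecSq ((F q).mulVec x) ≤ vecSq x :=
    vecSq_mulVec_le_of_opNorm_eq_one (hnorm q (hball.2 hq)) x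
  obtain ⟨x, hx1, hx2⟩ := exists_vecSq_mulVec_eq_one (hnorm 0 (hball.2 (by simp)))
  obtain ⟨W, hW, rfl⟩ := exists_unitary_col_eq hx1
  obtain ⟨y, hy, hyF⟩ := hreg.exists_series_mulVec (W.col 0)
  obtain ⟨U, hU, hUF⟩ := hreg.exists_series_mulVec (W.col 1)
  set v := (F 0).mulVec (W.col 0) with hv
  -- The first column of `F W` is constant by the maximum principle.
  have hFv (q : ℍ) (hq : ‖q‖ < 1) : (F q).mulVec (W.col 0) = v := by
    have hz (i : Fin 2) {n : ℕ} (hn : n ≠ 0) : PowerSeries.coeff n (y i) = 0 := by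
      refine coeff_eq_zero_of_maximum hy (fun q hq => ?_) ?_ i hn
      · simp only [hyF q hq]
        exact (hcontr q hq _).trans hx1.le
      · simp only [hyF 0 (by simp)]
        exact hx2
    have hconst (i : Fin 2) (q : ℍ) : seriesVal q (y i) = PowerSeries.coeff 0 (y i) := by
      rw [seriesVal, tsum_eq_single 0]
      · simp
      · intro n hn
        rw [hz i hn, mul_zero]
    ext1 i
    rw [hv, ← hyF q hq, ← hyF 0 (by simp), hconst, hconst]
  have hmul (q : ℍ) (hq : ‖q‖ < 1) (α β : ℍ) :
      (F q).mulVec (W.mulVec ![α, β])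
        = fun i => v i * α + seriesVal q (U i) * β := by
    ext1 i
    rw [← hFv q hq, hUF q hq]
    simp only [Matrix.mulVec, dotProduct, Fin.sum_univ_two, Matrix.col_apply, Matrix.cons_val_zero,
      Matrix.cons_val_one, mul_add, add_mul, mul_assoc]
    abel
  have hle (q : ℍ) (hq : ‖q‖ < 1) (α β : ℍ) :
      vecSq (fun i => v i * α + seriesVal q (U i) * β) ≤ ‖α‖ ^ 2 + ‖β‖ ^ 2 := by
    rw [← hmul q hq]
    refine (hcontr q hq _).trans (le_of_eq ?_)
    rw [vecSq_mulVec_of_mem_unitary hW]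
    simp [vecSq, Fin.sum_univ_two]
  have horth (q : ℍ) (hq : ‖q‖ < 1) :
      star (v 0) * seriesVal q (U 0) + star (v 1) * seriesVal q (U 1) = 0 :=
    star_dotProduct_eq_zero_of_contraction (u := fun i => seriesVal q (U i)) hx2 fun α => by
      simpa using hle q hq α 1
  have hUle (q : ℍ) (hq : ‖q‖ < 1) : ∑ i, ‖seriesVal q (U i)‖ ^ 2 ≤ 1 := by
    simpa [vecSq] using hle q hq 0 1
  have hFW (q : ℍ) (hq : ‖q‖ < 1) :
      F q = !![v 0, seriesVal q (U 0); v 1, seriesVal q (U 1)] * star W := by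
    have : F q * W = !![v 0, seriesVal q (U 0); v 1, seriesVal q (U 1)] := by
      ext1 i j
      have h0 := congrFun (hFv q hq) i
      have h1 := hUF q hq i
      change (F q).mulVec (W.col j) i = _
      fin_cases j <;> fin_cases i <;> first | exact h0 | exact h1.symm
    rw [← this, mul_assoc, (Unitary.mem_iff.1 hW).2, mul_one]
  -- Some non-constant coefficient of the second column does not vanish.
  obtain ⟨n, hn, hne⟩ : ∃ n ≠ 0, (fun i => PowerSeries.coeff n (U i)) ≠ 0 := by
    -- Otherwise `u`, and with it `F`, would be constant.
    by_contra! hall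
    have hconst (i : Fin 2) (q : ℍ) : seriesVal q (U i) = PowerSeries.coeff 0 (U i) := by
      rw [seriesVal, tsum_eq_single 0]
      · simp
      · intro n hn
        rw [congrFun (hall n hn) i]
        simp
    obtain ⟨p, hp, q, hq, hpq⟩ := hnonconst
    refine hpq ?_
    rw [hFW p (hball.1 hp), hFW q (hball.1 hq)]
    simp only [hconst]
  have hcoeff (i : Fin 2) (k : ℕ) : ‖PowerSeries.coeff k (U i)‖ ≤ 1 := by
    have h1 : ‖PowerSeries.coeff k (U i)‖ ^ 2 ≤ partialSq (U i) (k + 1) :=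
      Finset.single_le_sum (f := fun n => ‖PowerSeries.coeff n (U i)‖ ^ 2)
        (fun _ _ => by positivity) (Finset.self_mem_range_succ k)
    have h2 : partialSq (U i) (k + 1) ≤ ∑ i, partialSq (U i) (k + 1) :=
      Finset.single_le_sum (f := fun i => partialSq (U i) (k + 1))
        (fun _ _ => Finset.sum_nonneg fun _ _ => by positivity) (Finset.mem_univ i)
    exact (sq_le_one_iff₀ (norm_nonneg _)).1
      (h1.trans (h2.trans (sum_partialSq_le_one hU hUle (k + 1))))
  -- The orthogonality relation on the rays `t J`, `0 < t < 1`, separates the coefficients.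
  obtain ⟨a, b, s, hab, hs, hv0, hv1⟩ := exists_real_vector hx2 hne hn fun J hJ => by
    refine eq_zero_of_hasSum_smul_zero (B := ‖v 0‖ + ‖v 1‖) (c := fun k =>
      star (v 0) * J ^ k * PowerSeries.coeff k (U 0)
        + star (v 1) * J ^ k * PowerSeries.coeff k (U 1)) (fun k => ?_) (fun t h0 h1 => ?_) n
    · refine (norm_add_le _ _).trans ?_
      rw [norm_mul, norm_mul, norm_mul, norm_mul, norm_pow, hJ, one_pow, mul_one, mul_one,
        norm_star, norm_star]
      gcongr <;> exact mul_le_of_le_one_right (norm_nonneg _) (hcoeff _ k)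
    · have hq : ‖(t : ℍ) * J‖ < 1 := by
        rwa [norm_mul, hJ, mul_one, Quaternion.norm_coe, Real.norm_of_nonneg h0.le]
      have hsum := (((hU 0).hasSum hq).mul_left (star (v 0))).add
        (((hU 1).hasSum hq).mul_left (star (v 1)))
      rw [horth _ hq] at hsum
      convert! hsum using 1
      ext1 k
      rw [Quaternion.coe_mul_eq_smul, _root_.smul_pow]
      simp only [smul_add, mul_smul_comm, smul_mul_assoc, mul_assoc]
  have hss : star s * s = 1 := by
    rw [Quaternion.star_mul_self, Quaternion.normSq_eq_norm_mul_self, hs]; simp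
  have hs0 : star s ≠ 0 := fun h => by rw [h, zero_mul] at hss; exact zero_ne_one hss
  have horth' (q : ℍ) (hq : ‖q‖ < 1) :
      (a : ℍ) * seriesVal q (U 0) + (b : ℍ) * seriesVal q (U 1) = 0 := by
    have := horth q hq
    rw [hv0, hv1, star_mul, star_mul, Quaternion.star_coe, Quaternion.star_coe, mul_assoc,
      mul_assoc, ← mul_add] at this
    exact (mul_eq_zero.1 this).resolve_left hs0
  set f : PowerSeries ℍ := PowerSeries.C (a : ℍ) * U 1 - PowerSeries.C (b : ℍ) * U 0 with hf
  have hfsum (q : ℍ) (hq : ‖q‖ < 1) : HasSum (fun n => q ^ n * PowerSeries.coeff n f)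
      ((a : ℍ) * seriesVal q (U 1) - (b : ℍ) * seriesVal q (U 0)) := by
    convert! (((hU 1).hasSum hq).mul_left (a : ℍ)).sub
      (((hU 0).hasSum hq).mul_left (b : ℍ)) using 1
    ext1 n
    rw [hf, map_sub, PowerSeries.coeff_C_mul, PowerSeries.coeff_C_mul, mul_sub, ← mul_assoc,
      ← mul_assoc, ← mul_assoc, ← mul_assoc, Quaternion.coe_commutes, Quaternion.coe_commutes]
  have hfval (q : ℍ) (hq : ‖q‖ < 1) :
      seriesVal q f = (a : ℍ) * seriesVal q (U 1) - (b : ℍ) * seriesVal q (U 0) :=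
    (hfsum q hq).tsum_eq
  have habq : (a : ℍ) * a + (b : ℍ) * b = 1 := by
    rw [← Quaternion.coe_mul, ← Quaternion.coe_mul, ← Quaternion.coe_add, ← sq, ← sq, hab,
      Quaternion.coe_one]
  have hba : (b : ℍ) * a = a * b := Quaternion.coe_commutes b a
  have hU0 (q : ℍ) (hq : ‖q‖ < 1) : seriesVal q (U 0) = -b * seriesVal q f := by
    have h1 := horth' q hq
    rw [hfval q hq]
    calc seriesVal q (U 0) = ((a : ℍ) * a + b * b) * seriesVal q (U 0) := by rw [habq, one_mul]
      _ = a * (a * seriesVal q (U 0) + b * seriesVal q (U 1))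
          - (a * b) * seriesVal q (U 1) + b * b * seriesVal q (U 0) := by noncomm_ring
      _ = _ := by rw [h1, ← hba]; noncomm_ring
  have hU1 (q : ℍ) (hq : ‖q‖ < 1) : seriesVal q (U 1) = a * seriesVal q f := by
    have h1 := horth' q hq
    rw [hfval q hq]
    calc seriesVal q (U 1) = ((a : ℍ) * a + b * b) * seriesVal q (U 1) := by rw [habq, one_mul]
      _ = b * (a * seriesVal q (U 0) + b * seriesVal q (U 1))
          - (b * a) * seriesVal q (U 0) + a * a * seriesVal q (U 1) := by noncomm_ring
      _ = _ := by rw [h1, hba]; noncomm_ring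
  refine ⟨W, hW, a, b, s, f, hab, hs, convergesOnBall_of_summable fun q hq => (hfsum q hq).summable,
    fun q hq => ?_, fun q hq => ?_⟩
  · have h1 := hUle q hq
    rw [Fin.sum_univ_two, hU0 q hq, hU1 q hq, norm_mul, norm_mul, norm_neg, Quaternion.norm_coe,
      Quaternion.norm_coe, mul_pow, mul_pow, Real.norm_eq_abs, Real.norm_eq_abs, sq_abs, sq_abs,
      ← add_mul, add_comm (b ^ 2), hab, one_mul] at h1
    exact (sq_le_one_iff₀ (norm_nonneg _)).1 h1
  · rw [hFW q hq, hU0 q hq, hU1 q hq, hv0, hv1]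
    congr 1
    simp

/-! ### Rational inner matrix functions -/

lemma rotation_mem_unitary {a b : ℝ} (hab : a ^ 2 + b ^ 2 = 1) :
    !![(a : ℍ), -b; (b : ℍ), a] ∈ unitary (Matrix (Fin 2) (Fin 2) ℍ) := by
  have h1 : (a : ℍ) * a + (b : ℍ) * b = 1 := by
    rw [← Quaternion.coe_mul, ← Quaternion.coe_mul, ← Quaternion.coe_add, ← sq, ← sq, hab,
      Quaternion.coe_one]
  have h2 : (b : ℍ) * a = a * b := Quaternion.coe_commutes b a
  refine Unitary.mem_iff.2 ⟨?_, ?_⟩ <;> ext1 i j <;> fin_cases i <;> fin_cases j <;>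
    simp [Matrix.mul_apply, Fin.sum_univ_two, Matrix.star_apply, h1, h2, add_comm ((b : ℍ) * b)]

lemma diagonal_mem_unitary {s z : ℍ} (hs : ‖s‖ = 1) (hz : ‖z‖ = 1) :
    !![s, 0; 0, z] ∈ unitary (Matrix (Fin 2) (Fin 2) ℍ) := by
  have h (z : ℍ) (hz : ‖z‖ = 1) : star z * z = 1 ∧ z * star z = 1 := by
    rw [Quaternion.star_mul_self, Quaternion.self_mul_star, Quaternion.normSq_eq_norm_mul_self, hz]
    simp
  refine Unitary.mem_iff.2 ⟨?_, ?_⟩ <;> ext1 i j <;> fin_cases i <;> fin_cases j <;>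
    simp [Matrix.mul_apply, Fin.sum_univ_two, Matrix.star_apply, h s hs, h z hz]

/-- The matrix function `O diag(s, h^{-*} * g) W*`. -/
noncomputable def innerMatrix (a b : ℝ) (s : ℍ) (W : Matrix (Fin 2) (Fin 2) ℍ)
    (h g : Polynomial ℍ) (q : ℍ) : Matrix (Fin 2) (Fin 2) ℍ :=
  !![(a : ℍ), -b; (b : ℍ), a] * !![s, 0; 0, quotVal h g q] * star W

/-- Real factors on the left, quaternionic factors on the right and additive constants can be
absorbed into the numerator. -/
lemma IsInnerPair.isRational {h g : Polynomial ℍ} (hp : IsInnerPair h g) (α β : ℍ) (c : ℝ) :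
    IsRational fun q => α + c * quotVal h g q * β := by
  refine ⟨h, h * C α + g * C (c * β), fun q hq => ?_, fun q hq => ?_⟩
  · exact (hp q ((mem_ball_zero_iff.1 hq).le)).1
  · have h0 := hp.evalLeft_symmetrization_ne_zero (mem_ball_zero_iff.1 hq).le
    rw [mul_add, ← mul_assoc, ← mul_assoc, regConj_mul_self, evalLeft_add, evalLeft_mul_C,
      evalLeft_mul_C, mul_add, inv_mul_cancel_left₀ h0, ← mul_assoc, ← mul_assoc, ← quotVal]
    exact congrArg (α + · * β) (Quaternion.coe_commutes c _)

lemma IsInnerPair.isRationalMatrix_innerMatrix {h g : Polynomial ℍ} (hp : IsInnerPair h g)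
    (a b : ℝ) (s : ℍ) (W : Matrix (Fin 2) (Fin 2) ℍ) :
    IsRationalMatrix (innerMatrix a b s W h g) := by
  intro i j
  fin_cases i
  · convert! hp.isRational (a * s * star (W j 0)) (star (W j 1)) (-b) using 2 with q
    simp [innerMatrix, Matrix.mul_apply, Fin.sum_univ_two, Matrix.star_apply]
  · convert! hp.isRational (b * s * star (W j 0)) (star (W j 1)) a using 2 with q
    simp [innerMatrix, Matrix.mul_apply, Fin.sum_univ_two, Matrix.star_apply]

lemma IsInnerPair.isInner_innerMatrix {h g : Polynomial ℍ} (hp : IsInnerPair h g)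
    {a b : ℝ} (hab : a ^ 2 + b ^ 2 = 1) {s : ℍ} (hs : ‖s‖ = 1) {W : Matrix (Fin 2) (Fin 2) ℍ}
    (hW : W ∈ unitary (Matrix (Fin 2) (Fin 2) ℍ)) : IsInner (innerMatrix a b s W h g) := by
  intro q hq
  refine ⟨_, mul_mem (mul_mem (rotation_mem_unitary hab)
    (diagonal_mem_unitary hs (hp.norm_quotVal hq))) (Unitary.star_mem hW), ?_⟩
  have hc : ContinuousAt (fun q => !![s, 0; 0, quotVal h g q]) q := by
    refine continuousAt_pi.2 fun i => continuousAt_pi.2 fun j => ?_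
    fin_cases i <;> fin_cases j
    · exact continuousAt_const
    · exact continuousAt_const
    · exact continuousAt_const
    · exact hp.continuousAt_quotVal hq.le
  have hc' : ContinuousAt (innerMatrix a b s W h g) q :=
    (continuousAt_const.mul hc).mul continuousAt_const
  exact hc'.tendsto.mono_left nhdsWithin_le_nhds

/-- Factors which are unitary do not change the distance of the middle factors. -/
lemma opNorm_sub_innerMatrix_le {a b : ℝ} (hab : a ^ 2 + b ^ 2 = 1) (s : ℍ)
    {W : Matrix (Fin 2) (Fin 2) ℍ} (hW : W ∈ unitary (Matrix (Fin 2) (Fin 2) ℍ))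
    (h g : Polynomial ℍ) (q z : ℍ) :
    opNorm (!![(a : ℍ), -b; (b : ℍ), a] * !![s, 0; 0, z] * star W - innerMatrix a b s W h g q)
      ≤ ‖z - quotVal h g q‖ := by
  refine opNorm_le (norm_nonneg _) fun x => ?_
  rw [innerMatrix, ← sub_mul, ← mul_sub, ← Matrix.mulVec_mulVec, ← Matrix.mulVec_mulVec,
    vecSq_mulVec_of_mem_unitary (rotation_mem_unitary hab),
    ← vecSq_mulVec_of_mem_unitary (Unitary.star_mem hW) x]
  set y := (star W).mulVec x
  simp only [vecSq, Fin.sum_univ_two, Matrix.mulVec, dotProduct]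
  simp only [Matrix.sub_apply, Matrix.of_apply, Matrix.cons_val_zero, Matrix.cons_val_one,
    sub_self, zero_mul, zero_add, norm_zero, norm_mul, mul_pow, add_zero, mul_add]
  have : 0 ≤ ‖z - quotVal h g q‖ ^ 2 * ‖y 0‖ ^ 2 := by positivity
  linarith

end QuatApprox

theorem mainTheorem8 (F : ℍ → Matrix (Fin 2) (Fin 2) ℍ)
    (hreg : QuatApprox.IsRegularMatrix F)
    (hnorm : ∀ q ∈ QuatApprox.unitBall, QuatApprox.opNorm (F q) = 1)
    (hnonconst : ∃ p ∈ QuatApprox.unitBall, ∃ q ∈ QuatApprox.unitBall, F p ≠ F q) :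
    ∃ R : ℕ → ℍ → Matrix (Fin 2) (Fin 2) ℍ,
      (∀ m, QuatApprox.IsRationalMatrix (R m) ∧ QuatApprox.IsInner (R m)) ∧
      ∀ K : Set ℍ, K ⊆ QuatApprox.unitBall → IsCompact K →
        ∀ ε : ℝ, 0 < ε → ∀ᶠ m in atTop, ∀ q ∈ K, QuatApprox.opNorm (F q - R m q) < ε := by
  obtain ⟨W, hW, a, b, s, f, hab, hs, hf, hf1, hF⟩ :=
    QuatApprox.exists_factorization hreg hnorm hnonconst
  choose h g hp hhg using QuatApprox.exists_isInnerPair_norm_sub_le hf hf1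
  refine ⟨fun m => QuatApprox.innerMatrix a b s W (h m) (g m),
    fun m => ⟨(hp m).isRationalMatrix_innerMatrix a b s W, (hp m).isInner_innerMatrix hab hs hW⟩,
    fun K hK hKc ε hε => ?_⟩
  obtain ⟨ρ, h0, h1, hρ⟩ : ∃ ρ : ℝ, 0 ≤ ρ ∧ ρ < 1 ∧ ∀ q ∈ K, ‖q‖ ≤ ρ := by
    rcases K.eq_empty_or_nonempty with rfl | hne
    · exact ⟨0, le_rfl, one_pos, by simp⟩
    · obtain ⟨p, hpK, hmax⟩ := hKc.exists_isMaxOn hne continuous_norm.continuousOn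
      exact ⟨‖p‖, norm_nonneg p, mem_ball_zero_iff.1 (hK hpK), fun q hq => hmax hq⟩
  have hlim : Tendsto (fun m : ℕ => 2 * ρ ^ m * (1 - ρ)⁻¹) atTop (𝓝 0) := by
    simpa using ((tendsto_pow_atTop_nhds_zero_of_lt_one h0 h1).const_mul 2).mul_const (1 - ρ)⁻¹
  filter_upwards [hlim.eventually_lt_const hε] with m hm q hq
  have hq1 : ‖q‖ < 1 := (hρ q hq).trans_lt h1
  rw [hF q hq1]
  refine (QuatApprox.opNorm_sub_innerMatrix_le hab s hW _ _ q _).trans_lt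
    ((hhg m q hq1).trans_lt (lt_of_le_of_lt ?_ hm))
  have := hρ q hq
  have h2 : 0 < 1 - ρ := by linarith
  gcongr
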